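/- An instance of a Binary Function Optimization Problem (BFOP) consists of $n$ variables $x_1,\dots,x_n$ over a two-element domain $D$ and $m$ functions $f_1,\dots,f_m : D\times D\to\{0,1,\dots,d\}$ with real weights $w_1,\dots,w_m$, where $f_i$ is applied to a pair $(x_{i_1},x_{i_2})$ of distinct variables; the objective, to be maximized over assignments $\gamma$, is $\mathrm{obj}_w(\gamma)=\sum_{i=1}^m w_i\, f_i(\gamma(x_{i_1}),\gamma(x_{i_2}))$. MAX 2-CSP is the case in which every $f_i$ is the indicator function of a predicate (so $d=1$). A function $f:D\times D\to\mathbb R$ is separable if $f(x,y)=g(x)+h(y)$ for some unary functions $g,h$. The instance is complete if every pair of distinct variables is, in some order, the pair of arguments of at least one nonseparable $f_i$ (several functions on the same pair, and additional separable functions, are allowed). The 2-FLIP algorithm starts from an arbitrary assignment $\gamma$ and, as long as some assignment differing from $\gamma$ in at most two variables has a strictly larger objective, moves to such an assignment, chosen by an arbitrary pivoting rule; the only restriction is that it never flips two variables when flipping only one of these two would give a strictly larger objective than flipping both. It terminates when no such assignment exists. Theorem. There is an absolute constant $C$ such that the following holds. Let $d=d(n)$ be constant or, more generally, polynomially bounded,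 $d\le A n^k$ for constants $A,k\in\mathbb N$. Then there is a function $\delta(n)\to 0$ (depending only on $A$ and $k$) such that for every complete BFOP instance with $n$ variables, $m$ functions and values in $\{0,\dots,d\}$, every $\phi>0$, and all independent random weights $w_1,\dots,w_m$, each supported on $[-1,1]$ with a density bounded from above by $\phi$: with probability at least $1-\delta(n)$ over the draw of $w$, every implementation of 2-FLIP (every initial assignment and every pivoting rule) terminates after at most $$m\,\phi\, n^{C\log^{10} n}$$ steps. In particular, the same holds for every complete MAX 2-CSP instance with $n$ variables and $m$ constraints, with an absolute function $\delta(n)\to 0$. -/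

import Mathlib

open Filter Topology MeasureTheory

/-- Assignments of `n` variables over a two-element domain, which is taken to be `Bool`. -/
abbrev Config (n : ℕ) : Type := Fin n → Bool

/-- Flip the value of the variable `u`. -/
def Config.flip {n : ℕ} (γ : Config n) (u : Fin n) : Config n :=
  Function.update γ u (!γ u)

/-- A binary function is separable if it is a sum of two unary functions. -/
def Separable (f : Bool → Bool → ℝ) : Prop :=
  ∃ f₁ f₂ : Bool → ℝ, ∀ x y, f x y = f₁ x + f₂ y

/-- A Binary Function Optimization Problem, without its weights: `n` variables and `m` functions
with values in `{0, …, d}`, the `i`-th of which is applied to the (ordered) pair of distinct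
variables `fst i`, `snd i`. Separable functions and repeated pairs of arguments are allowed. -/
structure BFOP (n m d : ℕ) where
  fst : Fin m → Fin n
  snd : Fin m → Fin n
  fst_ne_snd : ∀ i, fst i ≠ snd i
  f : Fin m → Bool → Bool → ℕ
  f_le : ∀ i x y, f i x y ≤ d

namespace BFOP

variable {n m d : ℕ}

/-- Every pair of variables appears, in one of the two orders, as the pair of arguments of a
nonseparable function. -/
def Complete (I : BFOP n m d) : Prop :=
  ∀ u v : Fin n, u ≠ v → ∃ i : Fin m,
    ((I.fst i = u ∧ I.snd i = v) ∨ (I.fst i = v ∧ I.snd i = u)) ∧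
      ¬ Separable (fun x y => (I.f i x y : ℝ))

/-- The objective function, to be maximized, for the weights `w`. -/
noncomputable def obj (I : BFOP n m d) (w : Fin m → ℝ) (γ : Config n) : ℝ :=
  ∑ i, w i * (I.f i (γ (I.fst i)) (γ (I.snd i)) : ℝ)

/-- No change of the values of at most two variables improves the objective. -/
def IsTwoFlipOptimal (I : BFOP n m d) (w : Fin m → ℝ) (γ : Config n) : Prop :=
  ∀ γ' : Config n, hammingDist γ γ' ≤ 2 → I.obj w γ' ≤ I.obj w γ

/-- A step that 2-FLIP may take from `γ` to `γ'`: it flips one or two variables and strictly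
improves the objective; and it does not flip two variables if flipping only one of the two
would give a strictly better objective than flipping both. -/
def TwoFlipStep (I : BFOP n m d) (w : Fin m → ℝ) (γ γ' : Config n) : Prop :=
  hammingDist γ γ' ≤ 2 ∧ I.obj w γ < I.obj w γ' ∧
    (hammingDist γ γ' = 2 → ∀ u, γ u ≠ γ' u → I.obj w (γ.flip u) ≤ I.obj w γ')

/-- The sequence of assignments produced by some implementation of 2-FLIP, from any initial
assignment and with any (adaptive, possibly randomized) pivoting rule: as long as the current
assignment is not locally optimal, the algorithm takes an allowed step. The algorithm stops at the
first locally optimal assignment; later entries of the sequence are irrelevant. -/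
def IsTwoFlipExecution (I : BFOP n m d) (w : Fin m → ℝ) (γ : ℕ → Config n) : Prop :=
  ∀ t, ¬ I.IsTwoFlipOptimal w (γ t) → I.TwoFlipStep w (γ t) (γ (t + 1))

/-- With the weights `w`, every implementation of 2-FLIP terminates after at most `T` steps. -/
def TwoFlipTerminatesWithin (I : BFOP n m d) (w : Fin m → ℝ) (T : ℝ) : Prop :=
  ∀ γ : ℕ → Config n, I.IsTwoFlipExecution w γ →
    ∃ t : ℕ, (t : ℝ) ≤ T ∧ I.IsTwoFlipOptimal w (γ t)

end BFOP

/-- An instance of MAX 2-CSP, without its weights: `n` variables and `m` constraints, the `i`-th of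
which is a predicate on the pair of distinct variables `fst i`, `snd i`. -/
structure Max2CSP (n m : ℕ) where
  fst : Fin m → Fin n
  snd : Fin m → Fin n
  fst_ne_snd : ∀ i, fst i ≠ snd i
  pred : Fin m → Bool → Bool → Bool

/-- The indicator functions of the constraints: the objective becomes the sum of the weights of
the satisfied constraints. -/
def Max2CSP.toBFOP {n m : ℕ} (I : Max2CSP n m) : BFOP n m 1 where
  fst := I.fst
  snd := I.snd
  fst_ne_snd := I.fst_ne_snd
  f := fun i x y => if I.pred i x y then 1 else 0
  f_le := fun i x y => by split <;> simp

/-- A probability distribution on `[-1, 1]` that has a density bounded from above by `φ`. -/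
def IsSmoothedWeight (φ : ℝ) (μ : Measure ℝ) : Prop :=
  IsProbabilityMeasure μ ∧ μ (Set.Icc (-1) 1) = 1 ∧
    ∃ g : ℝ → ENNReal, Measurable g ∧ (∀ x, g x ≤ ENNReal.ofReal φ) ∧
      μ = (volume : Measure ℝ).withDensity g

/-! Let L = 2^D be slightly larger than a suitable constant times n. If any L consecutive improving
steps gain more than ε in total, then, since the objective lies in [-md, md], a run has at most
L(2md/ε + 1) steps. So it suffices to show that slow stretches, L improving steps with total gain at
most ε, are unlikely to exist. In a slow stretch every single step gains between 0 and ε.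

A dyadic peeling argument (`exists_window_denseCore`) finds in every stretch a window of length 2^j
and a set H of at least 2^j/(4KD) variables, K = 2^57, each flipped at least K times in the window
by steps that flip only variables of H. Completeness turns these repeated flips into at least 2|H|
linearly independent integral linear forms (`IsFlipPath.exists_independent_rows`).

A union bound over windows must not pay 2^n for the values of the variables that are never flipped.
These are reset to `false`, which changes the step gains only by an unknown field on the flipped
variables (`BFOP.exists_field`); (4n^2)^(2^j) windows remain. The selected steps involve only the
|H| unknown fields on H, half the number of forms at most, so `pi_exists_abs_le` still bounds by
(8nεφ)^|H| the probability that for some field all forms are at most ε in absolute value. With 8nεφ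
= (4n^4)^(-4KD) this is at most (4n^4)^(-2^j), which beats the number of windows.

Since D = O(log n), 1/ε is φ n^(O(log n)), and the exponent C log^10 n is generous. -/

section Combinatorics

/-! ### Dense windows, triangular families and colourings -/

variable {V : Type*}

/-- Every element of `H` occurs in at least `K` of the sets `S t`, `t ∈ W`, contained in `H`. -/
def IsDense [DecidableEq V] (S : ℕ → Finset V) (K : ℕ) (W : Finset ℕ) (H : Finset V) : Prop :=
  ∀ u ∈ H, K ≤ (W.filter fun t => u ∈ S t ∧ S t ⊆ H).card

open Classical in
/-- The largest dense set. -/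
noncomputable def denseCore [Fintype V] [DecidableEq V] (S : ℕ → Finset V) (K : ℕ) (W : Finset ℕ) : Finset V :=
  Finset.univ.filter fun u => ∃ H, IsDense S K W H ∧ u ∈ H

theorem IsDense.subset_denseCore [Fintype V] [DecidableEq V] {S : ℕ → Finset V} {K : ℕ} {W : Finset ℕ}
    {H : Finset V} (h : IsDense S K W H) : H ⊆ denseCore S K W := fun u hu => by
  simp only [denseCore, Finset.mem_filter, Finset.mem_univ, true_and]
  exact ⟨H, h, hu⟩

/-- Density survives unions: enlarging `H` only adds to the sets contained in it. -/
theorem isDense_denseCore [Fintype V] [DecidableEq V] (S : ℕ → Finset V) (K : ℕ) (W : Finset ℕ) :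
    IsDense S K W (denseCore S K W) := by
  intro u hu
  simp only [denseCore, Finset.mem_filter, Finset.mem_univ, true_and] at hu
  obtain ⟨H, hH, huH⟩ := hu
  refine (hH u huH).trans (Finset.card_le_card fun t => ?_)
  simp only [Finset.mem_filter]
  exact fun ⟨h1, h2, h3⟩ => ⟨h1, h2, h3.trans hH.subset_denseCore⟩

/-- Greedy peeling: while `X` is not inside the core, its union with the core is not dense, so some
`u` in `X` outside the core lies in fewer than `K` of the sets inside that union. Deleting `u` from
`X` loses fewer than `K` sets, and there are at most `X.card` deletions. -/
theorem card_not_subset_denseCore_le [Fintype V] [DecidableEq V] (S : ℕ → Finset V) (K : ℕ) (W : Finset ℕ)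
    (X : Finset V) :
    (W.filter fun t => S t ⊆ X ∧ ¬ S t ⊆ denseCore S K W).card ≤ K * X.card := by
  induction X using Finset.strongInduction with
  | H X ih =>
  by_cases hX : X ⊆ denseCore S K W
  · rw [Finset.filter_eq_empty_iff.2]
    · simp
    · rintro t - ⟨h1, h2⟩
      exact h2 (h1.trans hX)
  · have hnd : ¬ IsDense S K W (X ∪ denseCore S K W) := fun h =>
      hX (Finset.subset_union_left.trans h.subset_denseCore)
    simp only [IsDense, not_forall, not_le] at hnd
    obtain ⟨u, hu, hlt⟩ := hnd
    have hu' : u ∉ denseCore S K W := fun h => by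
      refine absurd (isDense_denseCore S K W u h) (not_le.2 (lt_of_le_of_lt ?_ hlt))
      refine Finset.card_le_card fun t => ?_
      simp only [Finset.mem_filter]
      exact fun ⟨h1, h2, h3⟩ => ⟨h1, h2, h3.trans Finset.subset_union_right⟩
    have huX : u ∈ X := (Finset.mem_union.1 hu).resolve_right hu'
    have := ih (X.erase u) (Finset.erase_ssubset huX)
    have hsub : (W.filter fun t => S t ⊆ X ∧ ¬ S t ⊆ denseCore S K W) ⊆
        (W.filter fun t => S t ⊆ X.erase u ∧ ¬ S t ⊆ denseCore S K W) ∪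
        (W.filter fun t => u ∈ S t ∧ S t ⊆ X ∪ denseCore S K W) := by
      intro t
      simp only [Finset.mem_filter, Finset.mem_union]
      rintro ⟨h1, h2, h3⟩
      by_cases hut : u ∈ S t
      · exact Or.inr ⟨h1, hut, h2.trans Finset.subset_union_left⟩
      · exact Or.inl ⟨h1, Finset.subset_erase.2 ⟨h2, hut⟩, h3⟩
    have hc := (Finset.card_le_card hsub).trans (Finset.card_union_le _ _)
    have : X.card = (X.erase u).card + 1 := (Finset.card_erase_add_one huX).symm
    rw [this, mul_add]
    omega

/-- Induction over dyadic windows. A set inside the core `H` of a window is inside the core of its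
half, or is among the at most `K * H.card` sets that peeling removes there. As no core is large, the
two halves together lose less than a fraction 1/(2D) of the window, so level `j` keeps at most a
fraction j/(2D) of its steps in the core. -/
theorem card_subset_denseCore_le [Fintype V] [DecidableEq V] (S : ℕ → Finset V) (K D : ℕ) (hK : 2 ≤ K)
    (hS : ∀ t < 2 ^ D, (S t).Nonempty)
    (hno : ∀ a j, j ≤ D → a + 2 ^ j ≤ 2 ^ D →
      4 * K * D * (denseCore S K (Finset.Ico a (a + 2 ^ j))).card < 2 ^ j) (j : ℕ) :
    ∀ a, j ≤ D → a + 2 ^ j ≤ 2 ^ D →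
      4 * K * D * ((Finset.Ico a (a + 2 ^ j)).filter fun t =>
        S t ⊆ denseCore S K (Finset.Ico a (a + 2 ^ j))).card ≤ 2 * K * j * 2 ^ j := by
  induction j with
  | zero =>
    intro a _ ha
    -- A window with a single step cannot give any variable `K ≥ 2` occurrences.
    have : ((Finset.Ico a (a + 2 ^ 0)).filter fun t =>
        S t ⊆ denseCore S K (Finset.Ico a (a + 2 ^ 0))) = ∅ := by
      rw [Finset.filter_eq_empty_iff]
      intro t ht hsub
      simp only [pow_zero, Finset.mem_Ico] at ht ha
      obtain ⟨u, hu⟩ := hS t (by omega)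
      have h1 := isDense_denseCore S K (Finset.Ico a (a + 2 ^ 0)) u (hsub hu)
      have h2 := h1.trans (Finset.card_le_card (Finset.filter_subset _ _))
      simp at h2
      omega
    rw [this]; simp
  | succ j ih =>
    intro a hj ha
    have e2 : 2 ^ (j + 1) = 2 ^ j + 2 ^ j := by ring
    have e3 : 0 < 2 ^ j := by positivity
    have h1 := ih a (by omega) (by omega)
    have h2 := ih (a + 2 ^ j) (by omega) (by rw [add_assoc, ← e2]; exact ha)
    have h3 := hno a (j + 1) hj ha
    set H := denseCore S K (Finset.Ico a (a + 2 ^ (j + 1))) with hH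
    have p1 := card_not_subset_denseCore_le S K (Finset.Ico a (a + 2 ^ j)) H
    have p2 := card_not_subset_denseCore_le S K (Finset.Ico (a + 2 ^ j) (a + 2 ^ j + 2 ^ j)) H
    have hsub : ((Finset.Ico a (a + 2 ^ (j + 1))).filter fun t => S t ⊆ H) ⊆
        (((Finset.Ico a (a + 2 ^ j)).filter fun t =>
          S t ⊆ denseCore S K (Finset.Ico a (a + 2 ^ j))) ∪
        ((Finset.Ico (a + 2 ^ j) (a + 2 ^ j + 2 ^ j)).filter fun t =>
          S t ⊆ denseCore S K (Finset.Ico (a + 2 ^ j) (a + 2 ^ j + 2 ^ j)))) ∪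
        (((Finset.Ico a (a + 2 ^ j)).filter fun t =>
          S t ⊆ H ∧ ¬ S t ⊆ denseCore S K (Finset.Ico a (a + 2 ^ j))) ∪
        ((Finset.Ico (a + 2 ^ j) (a + 2 ^ j + 2 ^ j)).filter fun t =>
          S t ⊆ H ∧ ¬ S t ⊆ denseCore S K (Finset.Ico (a + 2 ^ j) (a + 2 ^ j + 2 ^ j)))) := by
      intro t
      simp only [Finset.mem_filter, Finset.mem_union, Finset.mem_Ico]
      rintro ⟨⟨h1, h2⟩, h3⟩
      by_cases ht : t < a + 2 ^ j
      · by_cases hc : S t ⊆ denseCore S K (Finset.Ico a (a + 2 ^ j))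
        · exact Or.inl (Or.inl ⟨⟨h1, ht⟩, hc⟩)
        · exact Or.inr (Or.inl ⟨⟨h1, ht⟩, h3, hc⟩)
      · by_cases hc : S t ⊆ denseCore S K (Finset.Ico (a + 2 ^ j) (a + 2 ^ j + 2 ^ j))
        · exact Or.inl (Or.inr ⟨⟨by omega, by omega⟩, hc⟩)
        · exact Or.inr (Or.inr ⟨⟨by omega, by omega⟩, h3, hc⟩)
    have hc := (Finset.card_le_card hsub).trans ((Finset.card_union_le _ _).trans
      (add_le_add (Finset.card_union_le _ _) (Finset.card_union_le _ _)))
    have hc' := hc.trans (add_le_add le_rfl (add_le_add p1 p2))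
    generalize ((Finset.Ico a (a + 2 ^ j)).filter fun t =>
      S t ⊆ denseCore S K (Finset.Ico a (a + 2 ^ j))).card = A at h1 hc'
    generalize ((Finset.Ico (a + 2 ^ j) (a + 2 ^ j + 2 ^ j)).filter fun t =>
      S t ⊆ denseCore S K (Finset.Ico (a + 2 ^ j) (a + 2 ^ j + 2 ^ j))).card = B at h2 hc'
    calc _ ≤ 4 * K * D * (A + B + (K * H.card + K * H.card)) := Nat.mul_le_mul_left _ hc'
      _ = 4 * K * D * A + 4 * K * D * B + 2 * K * (4 * K * D * H.card) := by ring
      _ ≤ 2 * K * j * 2 ^ j + 2 * K * j * 2 ^ j + 2 * K * 2 ^ (j + 1) := by gcongr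
      _ = _ := by ring

/-- In a long sequence of nonempty sets some window has a large dense core. -/
theorem exists_window_denseCore [Fintype V] [DecidableEq V] (S : ℕ → Finset V) (K D : ℕ) (hK : 2 ≤ K)
    (hS : ∀ t < 2 ^ D, (S t).Nonempty) (hD : 2 * K * Fintype.card V < 2 ^ D) :
    ∃ a j, j ≤ D ∧ a + 2 ^ j ≤ 2 ^ D ∧
      2 ^ j ≤ 4 * K * D * (denseCore S K (Finset.Ico a (a + 2 ^ j))).card := by
  by_contra! hno
  have h1 := card_subset_denseCore_le S K D hK hS hno D 0 le_rfl (by simp)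
  have h2 := card_not_subset_denseCore_le S K (Finset.Ico 0 (0 + 2 ^ D)) Finset.univ
  simp only [Finset.subset_univ, true_and] at h2
  have h3 := Finset.card_filter_add_card_filter_not (s := Finset.Ico 0 (0 + 2 ^ D))
    (fun t => S t ⊆ denseCore S K (Finset.Ico 0 (0 + 2 ^ D)))
  rw [Nat.card_Ico] at h3
  simp only [zero_add, Nat.sub_zero] at h1 h2 h3
  rw [Finset.card_univ] at h2
  rcases Nat.eq_zero_or_pos D with rfl | hDpos
  · have := hno 0 0 le_rfl (by simp)
    have hV : Fintype.card V = 0 := by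
      by_contra h
      have : 1 ≤ Fintype.card V := Nat.one_le_iff_ne_zero.2 h
      have : 2 * K * 1 ≤ 2 * K * Fintype.card V := Nat.mul_le_mul_left _ this
      simp at hD; omega
    obtain ⟨u, -⟩ := hS 0 (by simp)
    exact (Fintype.card_eq_zero_iff.1 hV).false u
  -- At the top level at most half of the steps lie inside the core, and at most `K * Fintype.card
  -- V`, fewer than half, lie outside it.
  · have h4 : 2 * K * D * (2 * ((Finset.Ico 0 (2 ^ D)).filter fun t =>
        S t ⊆ denseCore S K (Finset.Ico 0 (2 ^ D))).card) ≤ 2 * K * D * 2 ^ D := by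
      calc _ = _ := by ring
        _ ≤ _ := h1
    have h5 := Nat.le_of_mul_le_mul_left h4 (by positivity)
    have : 2 * K * Fintype.card V = 2 * (K * Fintype.card V) := by ring
    omega

open Classical in
/-- A triangular family: `t j` is separated from all later `t l` by the coordinate `x j`. -/
theorem exists_triangular (s : ℕ → V → Bool) (S : ℕ → Finset V) (g : ℕ) :
    ∀ Z : Finset ℕ, 2 ^ (g + 3) ≤ Z.card →
    (∀ i ∈ Z, (Z.filter fun j => ∀ x, x ∉ S i → x ∉ S j → s i x = s j x).card ≤ 8) →
    ∃ (t : Fin g → ℕ) (x : Fin g → V), (∀ j, t j ∈ Z) ∧ (∀ j, x j ∉ S (t j)) ∧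
      ∀ j l, j < l → s (t l) (x j) ≠ s (t j) (x j) := by
  induction g with
  | zero => exact fun Z _ _ => ⟨Fin.elim0, Fin.elim0, fun j => j.elim0, fun j => j.elim0,
      fun j => j.elim0⟩
  | succ g ih =>
    intro Z hZ hbad
    have e1 : 2 ^ (g + 1 + 3) = 2 * 2 ^ (g + 3) := by ring
    have e2 : 2 ^ 3 ≤ 2 ^ (g + 3) := Nat.pow_le_pow_right (by norm_num) (by omega)
    obtain ⟨i, hi⟩ : Z.Nonempty := Finset.card_pos.1 (by omega)
    obtain ⟨j, hj, hij⟩ : ∃ j ∈ Z, ¬ ∀ x, x ∉ S i → x ∉ S j → s i x = s j x := by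
      by_contra! h
      have := hbad i hi
      rw [Finset.filter_true_of_mem h] at this
      omega
    push Not at hij
    obtain ⟨x, hxi, hxj, hne⟩ := hij
    have key : ∀ k ∈ Z, x ∉ S k → 2 ^ (g + 3) ≤ (Z.filter fun l => s l x ≠ s k x).card →
        ∃ (t : Fin (g + 1) → ℕ) (x : Fin (g + 1) → V), (∀ j, t j ∈ Z) ∧ (∀ j, x j ∉ S (t j)) ∧
          ∀ j l, j < l → s (t l) (x j) ≠ s (t j) (x j) := by
      intro k hk hxk hc
      obtain ⟨t', x', h1, h2, h3⟩ := ih _ hc fun i hi =>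
        (Finset.card_le_card (Finset.filter_subset_filter _ (Finset.filter_subset _ _))).trans
          (hbad i (Finset.mem_filter.1 hi).1)
      refine ⟨Fin.cons k t', Fin.cons x x', ?_, ?_, ?_⟩
      · refine Fin.cases hk fun j => ?_
        simpa using (Finset.mem_filter.1 (h1 j)).1
      · refine Fin.cases hxk fun j => ?_
        simpa using h2 j
      · intro a
        refine Fin.cases (fun l => ?_) (fun a l => ?_) a
        · refine Fin.cases (fun h => absurd h (lt_irrefl _)) (fun l _ => ?_) l
          simpa using (Finset.mem_filter.1 (h1 l)).2
        · refine Fin.cases (fun h => absurd h (by simp)) (fun l h => ?_) l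
          simpa using h3 a l (Fin.succ_lt_succ_iff.1 h)
    -- Since `i` and `j` differ at `x`, one of them differs there from at least half of `Z`; it
    -- becomes the first member, and the recursion continues in that half.
    have hsum := Finset.card_filter_add_card_filter_not (s := Z) (fun l => s l x ≠ s i x)
    rcases le_total (2 ^ (g + 3)) (Z.filter fun l => s l x ≠ s i x).card with h | h
    · exact key i hi hxi h
    · refine key j hj hxj ?_
      have : (Z.filter fun l => s l x ≠ s j x) = Z.filter fun l => ¬ s l x ≠ s i x := by
        refine Finset.filter_congr fun l _ => ?_
        revert hne
        cases s l x <;> cases s i x <;> cases s j x <;> simp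
      rw [this]
      omega

/-- A colouring with three colours that respects a good share of the given triples. -/
theorem exists_coloring [Fintype V] [DecidableEq V] {I : Type*} [Fintype I] (u v x : I → V)
    (hxu : ∀ i, x i ≠ u i) (hxv : ∀ i, x i ≠ v i) :
    ∃ c : V → Fin 3, Fintype.card I ≤ 27 *
      (Finset.univ.filter fun i => c (u i) = 0 ∧ c (x i) = 2 ∧ (v i = u i ∨ c (v i) = 1)).card := by
  have hcount : ∀ i, Fintype.card (V → Fin 3) ≤ 27 * (Finset.univ.filter fun c : V → Fin 3 =>
      c (u i) = 0 ∧ c (x i) = 2 ∧ (v i = u i ∨ c (v i) = 1)).card := by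
    intro i
    -- Repainting the three points makes any colouring good, and the three overwritten colours
    -- recover it: at most 27 colourings share an image. `u i` is painted last, so that it wins when
    -- `v i = u i`.
    let F : (V → Fin 3) → (V → Fin 3) × (Fin 3 × Fin 3 × Fin 3) := fun c =>
      (Function.update (Function.update (Function.update c (v i) 1) (x i) 2) (u i) 0,
        (c (u i), c (x i), c (v i)))
    have hmaps : Set.MapsTo F (Finset.univ : Finset (V → Fin 3))
        ((Finset.univ.filter fun c : V → Fin 3 =>
          c (u i) = 0 ∧ c (x i) = 2 ∧ (v i = u i ∨ c (v i) = 1)) ×ˢ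
          (Finset.univ : Finset (Fin 3 × Fin 3 × Fin 3)) : Finset _) := by
      intro c _
      simp only [Finset.coe_product, Set.mem_prod, Finset.mem_coe, Finset.mem_filter,
        Finset.mem_univ, true_and, and_true, F]
      refine ⟨by simp, by simp [hxu i], ?_⟩
      by_cases h : v i = u i
      · exact Or.inl h
      · right
        rw [Function.update_of_ne h, Function.update_of_ne (hxv i).symm, Function.update_self]
    have hinj : Set.InjOn F (Finset.univ : Finset (V → Fin 3)) := by
      intro c _ c' _ h
      simp only [F, Prod.mk.injEq] at h
      obtain ⟨h1, h2, h3, h4⟩ := h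
      funext a
      by_cases ha : a = u i
      · rw [ha, h2]
      by_cases hb : a = x i
      · rw [hb, h3]
      by_cases hd : a = v i
      · rw [hd, h4]
      simpa [ha, hb, hd] using congrFun h1 a
    have := Finset.card_le_card_of_injOn F hmaps hinj
    rw [Finset.card_product, Finset.card_univ, Finset.card_univ] at this
    simp only [Fintype.card_prod, Fintype.card_fin] at this ⊢
    omega
  have hne : (Finset.univ : Finset (V → Fin 3)).Nonempty := Finset.univ_nonempty
  obtain ⟨c, -, hc⟩ := Finset.exists_le_of_sum_le hne (f := fun _ => Fintype.card I)
    (g := fun c : V → Fin 3 => 27 * (Finset.univ.filter fun i =>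
      c (u i) = 0 ∧ c (x i) = 2 ∧ (v i = u i ∨ c (v i) = 1)).card) (by
    rw [← Finset.mul_sum, Finset.sum_const, Finset.card_univ, smul_eq_mul]
    simp_rw [Finset.card_filter]
    rw [Finset.sum_comm, Finset.mul_sum]
    calc Fintype.card (V → Fin 3) * Fintype.card I
        = ∑ _i : I, Fintype.card (V → Fin 3) := by simp [mul_comm]
      _ ≤ _ := Finset.sum_le_sum fun i _ => by
        simpa only [Finset.card_filter] using hcount i)
  exact ⟨c, hc⟩

end Combinatorics

/-! ### Volumes and product measures -/

section Volume

theorem pi_le_pi_of_le {ι : Type*} [Fintype ι] {μ ν : ι → Measure ℝ} [∀ i, SigmaFinite (μ i)]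
    (h : ∀ i, μ i ≤ ν i) : Measure.pi μ ≤ Measure.pi ν := by
  refine Measure.le_iff.2 fun s hs => ?_
  have : (Measure.pi μ).toOuterMeasure ≤ OuterMeasure.pi fun i => (ν i).toOuterMeasure := by
    rw [OuterMeasure.le_pi]
    intro t _
    change Measure.pi μ (Set.univ.pi t) ≤ _
    rw [Measure.pi_pi]
    exact Finset.prod_le_prod' fun i _ => h i _
  rw [show Measure.pi ν s = OuterMeasure.pi (fun i => (ν i).toOuterMeasure) s by
    rw [Measure.pi, toMeasure_apply _ _ hs]]
  exact this s

theorem pi_smul_volume {ι : Type*} [Fintype ι] (c : NNReal) :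
    Measure.pi (fun _ : ι => c • (volume : Measure ℝ)) =
      c ^ Fintype.card ι • (volume : Measure (ι → ℝ)) := by
  refine Measure.pi_eq fun s _ => ?_
  rw [Measure.smul_apply, volume_pi_pi]
  simp only [Measure.smul_apply, ENNReal.smul_def, smul_eq_mul, Finset.prod_mul_distrib,
    Finset.prod_const, Finset.card_univ, ENNReal.coe_pow]

theorem pi_le_of_le_smul_volume {ι : Type*} [Fintype ι] {μ : ι → Measure ℝ}
    [∀ i, SigmaFinite (μ i)] {φ : ℝ} (h : ∀ i, μ i ≤ φ.toNNReal • volume) (s : Set (ι → ℝ)) :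
    Measure.pi μ s ≤ ENNReal.ofReal φ ^ Fintype.card ι * volume s := by
  refine (pi_le_pi_of_le h s).trans ?_
  rw [pi_smul_volume, Measure.smul_apply, ENNReal.smul_def]
  simp [ENNReal.ofReal]

theorem volume_abs_le {ι : Type*} [Fintype ι] (η : ℝ) (c : ι → ℝ) :
    volume {z : ι → ℝ | ∀ t, |z t + c t| ≤ η} = ENNReal.ofReal (2 * η) ^ Fintype.card ι := by
  have : {z : ι → ℝ | ∀ t, |z t + c t| ≤ η} =
      Set.univ.pi fun t => Set.Icc (-η - c t) (η - c t) := by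
    ext z
    simp only [Set.mem_ofPred_eq, Set.mem_pi, Set.mem_univ, true_imp_iff, Set.mem_Icc, abs_le]
    exact forall_congr' fun t => by constructor <;> rintro ⟨h1, h2⟩ <;> constructor <;> linarith
  rw [this, volume_pi_pi]
  simp only [Real.volume_Icc]
  rw [Finset.prod_congr rfl (g := fun _ => ENNReal.ofReal (2 * η))]
  · simp
  · intro t _; congr 1; ring

theorem volume_abs_mulVec_le {ι : Type*} [Fintype ι] [DecidableEq ι] (M : Matrix ι ι ℝ)
    (hM : 1 ≤ |M.det|) (η : ℝ) (c : ι → ℝ) :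
    volume {z : ι → ℝ | ∀ t, |M.mulVec z t + c t| ≤ η} ≤
      ENNReal.ofReal (2 * η) ^ Fintype.card ι := by
  have hdet : LinearMap.det (Matrix.toLin' M) ≠ 0 := by
    rw [LinearMap.det_toLin']
    intro h; rw [h] at hM; norm_num at hM
  have := Measure.addHaar_preimage_linearMap (volume : Measure (ι → ℝ)) hdet
    {z : ι → ℝ | ∀ t, |z t + c t| ≤ η}
  rw [volume_abs_le] at this
  have e : {z : ι → ℝ | ∀ t, |M.mulVec z t + c t| ≤ η} =
    Matrix.toLin' M ⁻¹' {z : ι → ℝ | ∀ t, |z t + c t| ≤ η} := by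
    ext z; simp
  rw [e, this, LinearMap.det_toLin']
  refine mul_le_of_le_one_left' ?_
  rw [ENNReal.ofReal_le_one, abs_inv]
  exact inv_le_one_of_one_le₀ hM

/-- Replacing "some `h` works" by "a large volume of `h` works" gives an event whose measurability
follows from Fubini. -/
theorem measurable_volume_fiber {α γ T : Type*} [Fintype α] [Fintype γ] [Fintype T]
    (A : T → (α → ℝ) × (γ → ℝ) → ℝ) (hA : ∀ t, Continuous (A t)) (η : ℝ) (r : ENNReal) :
    MeasurableSet {w : γ → ℝ | r ≤ volume {h : α → ℝ | ∀ t, |A t (h, w)| ≤ η}} := by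
  let F : Set ((α → ℝ) × (γ → ℝ)) := {p | ∀ t, |A t p| ≤ η}
  have hF : MeasurableSet F := by
    have : F = ⋂ t, {p | |A t p| ≤ η} := by ext; simp [F]
    rw [this]
    exact MeasurableSet.iInter fun t =>
      (isClosed_le (hA t).abs continuous_const).measurableSet
  exact measurableSet_le measurable_const (measurable_measure_prodMk_right hF)

variable {α β : Type*} [Fintype α] [Fintype β] [DecidableEq α] [DecidableEq β]

/-- Vectors `y` for which many `h` make all the entries of `M (h, y) + c` small. -/
theorem volume_fiber_le (M : Matrix (α ⊕ β) (α ⊕ β) ℝ)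
    (hM : 1 ≤ |M.det|) (η r : ℝ) (hr : 0 < r) (c : α ⊕ β → ℝ) :
    volume {y : β → ℝ | ENNReal.ofReal r ≤
      volume {h : α → ℝ | ∀ t, |M.mulVec (Sum.elim h y) t + c t| ≤ η}} ≤
      ENNReal.ofReal (2 * η) ^ (Fintype.card α + Fintype.card β) / ENNReal.ofReal r := by
  let F : Set ((α → ℝ) × (β → ℝ)) :=
    {p | ∀ t, |M.mulVec (Sum.elim p.1 p.2) t + c t| ≤ η}
  have hcont : ∀ t, Continuous fun p : (α → ℝ) × (β → ℝ) =>
      |M.mulVec (Sum.elim p.1 p.2) t + c t| := by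
    intro t
    simp only [Matrix.mulVec, dotProduct, Fintype.sum_sum_type, Sum.elim_inl, Sum.elim_inr]
    fun_prop
  have hF : MeasurableSet F := by
    have : F = ⋂ t, {p | |M.mulVec (Sum.elim p.1 p.2) t + c t| ≤ η} := by
      ext; simp [F]
    rw [this]
    exact MeasurableSet.iInter fun t => (isClosed_le (hcont t) continuous_const).measurableSet
  have hvol : (volume.prod volume) F ≤
      ENNReal.ofReal (2 * η) ^ (Fintype.card α + Fintype.card β) := by
    have h1 := volume_measurePreserving_sumPiEquivProdPi (fun _ : α ⊕ β => ℝ)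
    have h2 := h1.measure_preimage hF.nullMeasurableSet
    rw [Measure.volume_eq_prod] at h2
    rw [← h2, ← Fintype.card_sum]
    refine le_trans (measure_mono ?_) (volume_abs_mulVec_le M hM η c)
    intro z hz t
    have := hz t
    convert this using 4
    ext a; cases a <;> rfl
  have hmeas : Measurable fun y : β → ℝ =>
      (volume : Measure (α → ℝ)) ((fun h => (h, y)) ⁻¹' F) := measurable_measure_prodMk_right hF
  rw [ENNReal.le_div_iff_mul_le (Or.inl (by simpa using hr)) (Or.inl ENNReal.ofReal_ne_top),
    mul_comm]
  -- Markov's inequality for the fibre volume, whose integral is the volume of `F`.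
  refine le_trans (mul_meas_ge_le_lintegral hmeas (ENNReal.ofReal r)) ?_
  rw [← Measure.prod_apply_symm hF]
  exact hvol

/-- A bound on the conditional probabilities of an event is a bound on its probability. -/
theorem pi_le_of_slices {γ : Type*} [Fintype γ] (p : γ → Prop) [DecidablePred p]
    (μ : γ → Measure ℝ) [∀ i, IsProbabilityMeasure (μ i)] {G : Set (γ → ℝ)} (hG : MeasurableSet G)
    (b : ENNReal) (h : ∀ z : {i // ¬ p i} → ℝ, Measure.pi (fun i : {i // p i} => μ i)
      {y | (fun i => if hi : p i then y ⟨i, hi⟩ else z ⟨i, hi⟩) ∈ G} ≤ b) :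
    Measure.pi μ G ≤ b := by
  have h1 := measurePreserving_piEquivPiSubtypeProd μ p
  have h2 := (h1.symm _).measure_preimage hG.nullMeasurableSet
  rw [← h2, Measure.prod_apply_symm ((h1.symm _).measurable hG)]
  refine (lintegral_mono fun z => h z).trans ?_
  simp

end Volume

/-! ### Anti-concentration with unknown parameters -/

section Elimination

variable {H γ ι : Type*} [Fintype H] [Fintype ι]

/-- A nonsingular square submatrix whose columns from `P` span all the columns of `P`. -/
theorem exists_column_basis [Finite γ] (X : ι → H ⊕ γ → ℤ)
    (hX : LinearIndependent ℝ fun k => fun j => (X k j : ℝ)) :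
    ∃ b : Set (H ⊕ γ),
      (∃ f : ({a : H // Sum.inl a ∈ b} ⊕ {i : γ // Sum.inr i ∈ b}) ≃ ι,
        ∀ [DecidableEq ({a : H // Sum.inl a ∈ b} ⊕ {i : γ // Sum.inr i ∈ b})]
          [Fintype ({a : H // Sum.inl a ∈ b} ⊕ {i : γ // Sum.inr i ∈ b})],
          1 ≤ |(Matrix.of fun s t => (X (f s) (Sum.map Subtype.val Subtype.val t) : ℝ)).det|) ∧
      ∀ h : H → ℝ, ∃ h' : {a : H // Sum.inl a ∈ b} → ℝ,
        ∀ [Fintype {a : H // Sum.inl a ∈ b}],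
        ∀ k, ∑ a, (X k (Sum.inl a) : ℝ) * h a = ∑ a, (X k (Sum.inl a.1) : ℝ) * h' a := by
  classical
  have := Fintype.ofFinite γ
  let v : H ⊕ γ → ι → ℝ := fun j k => X k j
  -- The basis starts with columns from `H`: the remaining columns of `H` are spanned by those
  -- chosen, so their unknowns can be absorbed into `h'`.
  obtain ⟨b₁, hb₁t, -, hb₁s, hb₁⟩ := exists_linearIndepOn_extension
    (linearIndepOn_empty ℝ v) (Set.empty_subset (Set.range Sum.inl))
  obtain ⟨b, -, hb₁b, hbs, hb⟩ := exists_linearIndepOn_extension hb₁ (Set.subset_univ b₁)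
  have hspan : Submodule.span ℝ (v '' b) = ⊤ := by
    have h1 : (Matrix.of fun k j => (X k j : ℝ)).rank = Fintype.card ι :=
      LinearIndependent.rank_matrix hX
    rw [Matrix.rank_eq_finrank_span_cols] at h1
    have h2 : Submodule.span ℝ (Set.range v) = ⊤ := by
      apply Submodule.eq_top_of_finrank_eq
      rw [Module.finrank_fintype_fun_eq_card, ← h1]
      rfl
    rw [eq_top_iff, ← h2, ← Set.image_univ]
    exact Submodule.span_le.2 hbs
  have hbasis : Submodule.span ℝ (Set.range fun j : b => v j) = ⊤ := by
    rw [← hspan, Set.image_eq_range]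
  let B := Module.Basis.mk (v := fun j : b => v j) hb hbasis.ge
  have hcard : Fintype.card b = Fintype.card ι := by
    rw [← Module.finrank_eq_card_basis B, Module.finrank_fintype_fun_eq_card]
  let e : ({a : H // Sum.inl a ∈ b} ⊕ {i : γ // Sum.inr i ∈ b}) ≃ b :=
    (Equiv.subtypeSum (p := fun j => j ∈ b)).symm
  have he : ∀ t, (e t : H ⊕ γ) = Sum.map Subtype.val Subtype.val t := by
    rintro (a | i) <;> rfl
  refine ⟨b, ⟨e.trans (Fintype.equivOfCardEq hcard), ?_⟩, ?_⟩
  · intro _ _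
    set f := e.trans (Fintype.equivOfCardEq hcard) with hf
    have hint : (Matrix.of fun s (t : ({a : H // Sum.inl a ∈ b} ⊕ {i : γ // Sum.inr i ∈ b})) =>
          (X (f s) (Sum.map Subtype.val Subtype.val t) : ℝ)) =
        (Matrix.of fun s (t : ({a : H // Sum.inl a ∈ b} ⊕ {i : γ // Sum.inr i ∈ b})) =>
          X (f s) (Sum.map Subtype.val Subtype.val t)).map
          (Int.castRingHom ℝ) := by
      ext s t; simp
    have hdet : (Matrix.of fun s (t : ({a : H // Sum.inl a ∈ b} ⊕ {i : γ // Sum.inr i ∈ b})) =>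
        (X (f s) (Sum.map Subtype.val Subtype.val t) : ℝ)).det ≠ 0 := by
      have : IsUnit (Matrix.of fun s (t : ({a : H // Sum.inl a ∈ b} ⊕ {i : γ // Sum.inr i ∈ b})) =>
          (X (f s) (Sum.map Subtype.val Subtype.val t) : ℝ)) := by
        rw [← Matrix.linearIndependent_cols_iff_isUnit]
        have h1 : LinearIndependent ℝ fun t => v (e t) := hb.comp e e.injective
        have h2 := h1.map' (LinearEquiv.funCongrLeft ℝ ℝ f).toLinearMap (LinearEquiv.ker _)
        have h3 : (Matrix.of fun s (t : ({a : H // Sum.inl a ∈ b} ⊕ {i : γ // Sum.inr i ∈ b})) =>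
            (X (f s) (Sum.map Subtype.val Subtype.val t) : ℝ)).col =
            (LinearEquiv.funCongrLeft ℝ ℝ f).toLinearMap ∘ fun t => v (e t) := by
          ext t s
          simp [v, he, Matrix.col, LinearEquiv.funCongrLeft]
        rw [h3]
        exact h2
      exact ((Matrix.isUnit_iff_isUnit_det _).1 this).ne_zero
    rw [hint, ← RingHom.mapMatrix_apply, ← RingHom.map_det] at hdet ⊢
    rw [eq_intCast] at hdet ⊢
    rw [← Int.cast_abs]
    exact_mod_cast Int.one_le_abs (by exact_mod_cast hdet)
  · intro h
    have hmem : ∑ a, h a • v (Sum.inl a) ∈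
        Submodule.span ℝ (Set.range fun a : {a : H // Sum.inl a ∈ b} => v (Sum.inl a.1)) := by
      refine Submodule.sum_mem _ fun a _ => Submodule.smul_mem _ _ ?_
      have h1 : v (Sum.inl a) ∈ Submodule.span ℝ (v '' b₁) :=
        hb₁s ⟨Sum.inl a, ⟨a, rfl⟩, rfl⟩
      refine Submodule.span_mono ?_ h1
      rintro _ ⟨j, hj, rfl⟩
      obtain ⟨a', rfl⟩ := hb₁t hj
      exact ⟨⟨a', hb₁b hj⟩, rfl⟩
    obtain ⟨h', hh'⟩ := (Submodule.mem_span_range_iff_exists_fun ℝ).1 hmem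
    refine ⟨h', fun {_} k => ?_⟩
    have := congrFun hh' k
    simp only [Finset.sum_apply, Pi.smul_apply, smul_eq_mul, v] at this
    calc _ = ∑ a, h a * (X k (Sum.inl a) : ℝ) := by simp_rw [mul_comm]
      _ = _ := by rw [← this]; simp_rw [mul_comm]; congr!

/-- Anti-concentration in the presence of unknown parameters `h`: integral linear forms in the
smoothed weights and in fewer unknowns are unlikely to be small simultaneously. -/
theorem pi_exists_abs_le [Fintype γ] (X : ι → H ⊕ γ → ℤ)
    (hX : LinearIndependent ℝ fun k => fun j => (X k j : ℝ))
    (hX1 : ∀ k a, |X k (Sum.inl a)| ≤ 1) (hcard : 2 * Fintype.card H ≤ Fintype.card ι)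
    (n : ℕ) (hn : 0 < n) (hHn : Fintype.card H ≤ n) (μ : γ → Measure ℝ)
    [∀ i, IsProbabilityMeasure (μ i)] (φ ε : ℝ) (hφ : 0 < φ) (hε : 0 < ε)
    (hμ : ∀ i, μ i ≤ φ.toNNReal • volume) (hsmall : 8 * n * ε * φ ≤ 1) :
    Measure.pi μ {w | ∃ h : H → ℝ, ∀ k, |∑ a, (X k (Sum.inl a) : ℝ) * h a +
      ∑ i, (X k (Sum.inr i) : ℝ) * w i| ≤ ε} ≤
      ENNReal.ofReal ((8 * n * ε * φ) ^ Fintype.card H) := by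
  classical
  obtain ⟨b, ⟨f, hdet⟩, hh⟩ := exists_column_basis X hX
  let α := {a : H // Sum.inl a ∈ b}
  let β := {i : γ // Sum.inr i ∈ b}
  have hn' : (0 : ℝ) < n := by exact_mod_cast hn
  have hαH : Fintype.card α ≤ Fintype.card H := Fintype.card_subtype_le _
  have hαβ : Fintype.card α + Fintype.card β = Fintype.card ι := by
    rw [← Fintype.card_sum]; exact Fintype.card_congr f
  -- This is the volume of the box of radius `ε / n` around `h'`. Moving inside it changes each form
  -- by at most `ε`, as there are at most `n` unknowns with coefficients at most 1 in absolute
  -- value; hence the slack `2 * ε` in `G`.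
  set r : ℝ := (2 * (ε / n)) ^ Fintype.card α with hr
  have hr0 : 0 < r := by positivity
  let G : Set (γ → ℝ) := {w | ENNReal.ofReal r ≤ volume {h : α → ℝ | ∀ t : α ⊕ β,
    |∑ a : α, (X (f t) (Sum.inl a.1) : ℝ) * h a + ∑ i, (X (f t) (Sum.inr i) : ℝ) * w i| ≤ 2 * ε}}
  have hG : MeasurableSet G := by
    refine measurable_volume_fiber (T := α ⊕ β) (fun t (p : (α → ℝ) × (γ → ℝ)) =>
      ∑ a : α, (X (f t) (Sum.inl a.1) : ℝ) * p.1 a + ∑ i, (X (f t) (Sum.inr i) : ℝ) * p.2 i)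
      (fun t => ?_) (2 * ε) _
    fun_prop
  refine (measure_mono (t := G) ?_).trans ((pi_le_of_slices (fun i => Sum.inr i ∈ b) μ hG
    (ENNReal.ofReal φ ^ Fintype.card β * (ENNReal.ofReal (2 * (2 * ε)) ^
      (Fintype.card α + Fintype.card β) / ENNReal.ofReal r)) ?_).trans ?_)
  · rintro w ⟨h, hw⟩
    obtain ⟨h', hh'⟩ := hh h
    change ENNReal.ofReal r ≤ volume _
    rw [hr, ENNReal.ofReal_pow (by positivity), ← volume_abs_le (ε / n) fun a : α => - h' a]
    refine measure_mono fun z hz t => ?_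
    have h1 := hw (f t)
    rw [hh' (f t)] at h1
    have h2 : |∑ a : α, (X (f t) (Sum.inl a.1) : ℝ) * (z a + - h' a)| ≤ ε := by
      refine (Finset.abs_sum_le_sum_abs _ _).trans ?_
      calc _ ≤ ∑ a : α, ε / n := by
            refine Finset.sum_le_sum fun a _ => ?_
            rw [abs_mul]
            have h3 : |(X (f t) (Sum.inl a.1) : ℝ)| ≤ 1 := by exact_mod_cast hX1 (f t) a.1
            calc _ ≤ 1 * (ε / n) := mul_le_mul h3 (hz a) (abs_nonneg _) (by norm_num)
              _ = _ := one_mul _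
        _ = Fintype.card α * (ε / n) := by simp
        _ ≤ n * (ε / n) := by
            gcongr
            exact_mod_cast hαH.trans hHn
        _ = ε := by field_simp
    have h4 : ∑ a : α, (X (f t) (Sum.inl a.1) : ℝ) * z a +
          ∑ i, (X (f t) (Sum.inr i) : ℝ) * w i =
        (∑ a : α, (X (f t) (Sum.inl a.1) : ℝ) * h' a + ∑ i, (X (f t) (Sum.inr i) : ℝ) * w i) +
          ∑ a : α, (X (f t) (Sum.inl a.1) : ℝ) * (z a + - h' a) := by
      simp only [mul_add, Finset.sum_add_distrib, mul_neg, Finset.sum_neg_distrib]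
      ring
    rw [h4]
    refine (abs_add_le _ _).trans ?_
    linarith
  · intro z
    refine (pi_le_of_le_smul_volume (μ := fun i : β => μ i) (fun i => hμ i) _).trans ?_
    gcongr
    refine le_trans (measure_mono ?_) (volume_fiber_le _ hdet (2 * ε) r hr0
      fun t => ∑ i : {i : γ // ¬ Sum.inr i ∈ b}, (X (f t) (Sum.inr i.1) : ℝ) * z i)
    intro y hy
    refine le_trans (show ENNReal.ofReal r ≤ _ from hy) (le_of_eq ?_)
    congr 1
    ext h
    refine forall_congr' fun t => ?_
    rw [← Fintype.sum_subtype_add_sum_subtype (fun i => Sum.inr i ∈ b)]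
    simp only [Matrix.mulVec, dotProduct, Fintype.sum_sum_type, Sum.elim_inl, Sum.elim_inr,
      Matrix.of_apply, Sum.map_inl, Sum.map_inr]
    rw [add_assoc]
    have e1 : ∀ i : {i : γ // Sum.inr i ∈ b}, (if hi : Sum.inr i.1 ∈ b then y ⟨i.1, hi⟩
      else z ⟨i.1, hi⟩) = y i := fun i => dif_pos i.2
    have e2 : ∀ i : {i : γ // ¬ Sum.inr i ∈ b}, (if hi : Sum.inr i.1 ∈ b then y ⟨i.1, hi⟩
      else z ⟨i.1, hi⟩) = z i := fun i => dif_neg i.2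
    simp only [e1, e2]
    rfl
  · rw [← ENNReal.ofReal_pow hφ.le, ← ENNReal.ofReal_pow (by positivity),
      ← ENNReal.ofReal_div_of_pos hr0, ← ENNReal.ofReal_mul (by positivity)]
    refine ENNReal.ofReal_le_ofReal ?_
    have e : φ ^ Fintype.card β * ((2 * (2 * ε)) ^ (Fintype.card α + Fintype.card β) / r) =
        (4 * ε * φ) ^ Fintype.card β * (2 * n) ^ Fintype.card α := by
      rw [hr, pow_add, mul_comm ((2 * (2 * ε)) ^ Fintype.card α), mul_div_assoc, ← div_pow,
        ← mul_assoc, ← mul_pow]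
      congr 2
      · ring
      · field_simp
    rw [e]
    -- At most `card H` basis columns are unknowns, so at least `card H` of the `2 * card H` or more
    -- belong to weights.
    have hβ : Fintype.card H ≤ Fintype.card β := by omega
    have h2n : (1 : ℝ) ≤ 2 * n := by
      have : (1 : ℝ) ≤ n := by exact_mod_cast hn
      linarith
    calc (4 * ε * φ) ^ Fintype.card β * (2 * n) ^ Fintype.card α
        ≤ (4 * ε * φ) ^ Fintype.card β * (2 * (n : ℝ)) ^ Fintype.card β := by
          gcongr ?_ * ?_
          exact pow_le_pow_right₀ h2n (by omega)
      _ = (8 * n * ε * φ) ^ Fintype.card β := by rw [← mul_pow]; congr 1; ring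
      _ ≤ _ := pow_le_pow_of_le_one (by positivity) hsmall hβ

end Elimination

/-! ### Independent linear forms from flip paths -/

section Paths

variable {n : ℕ}

/-- The set of variables that the `t`-th step of the sequence `γ` flips. -/
def movedSet (γ : ℕ → Config n) (t : ℕ) : Finset (Fin n) :=
  Finset.univ.filter fun x => γ t x ≠ γ (t + 1) x

theorem mem_movedSet {γ : ℕ → Config n} {t : ℕ} {x : Fin n} :
    x ∈ movedSet γ t ↔ γ t x ≠ γ (t + 1) x := by simp [movedSet]

theorem notMem_movedSet {γ : ℕ → Config n} {t : ℕ} {x : Fin n} :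
    x ∉ movedSet γ t ↔ γ t x = γ (t + 1) x := by simp [movedSet]

/-- The first `ℓ` steps flip at most two variables each and visit no assignment twice. -/
structure IsFlipPath (γ : ℕ → Config n) (ℓ : ℕ) : Prop where
  card_le : ∀ t < ℓ, (movedSet γ t).card ≤ 2
  inj : ∀ s ≤ ℓ, ∀ t ≤ ℓ, γ s = γ t → s = t

theorem card_agree_outside_le (σ : Config n) (S : Finset (Fin n)) (hS : S.card ≤ 2) :
    (Finset.univ.filter fun τ : Config n => ∀ x, x ∉ S → σ x = τ x).card ≤ 4 := by
  have hinj : Set.InjOn (fun (τ : Config n) (x : S) => τ x)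
      (Finset.univ.filter fun τ : Config n => ∀ x, x ∉ S → σ x = τ x) := by
    intro τ hτ τ' hτ' h
    simp only [Finset.coe_filter, Finset.mem_univ, true_and, Set.mem_ofPred_eq] at hτ hτ'
    funext x
    by_cases hx : x ∈ S
    · exact congrFun h ⟨x, hx⟩
    · rw [← hτ x hx, ← hτ' x hx]
  have := Finset.card_le_card_of_injOn (t := (Finset.univ : Finset (S → Bool))) _
    (fun _ _ => Finset.mem_coe.2 (Finset.mem_univ _)) hinj
  refine this.trans ?_
  rw [Finset.card_univ, Fintype.card_fun, Fintype.card_bool, Fintype.card_coe]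
  exact (Nat.pow_le_pow_right (by norm_num) hS).trans (by norm_num)

open Classical in
-- Both steps flip `u`, so step `j` flips at most one variable outside `movedSet γ i`. Values being
-- Boolean, `γ j` or `γ (j + 1)` agrees with `γ i` there, and hence off `movedSet γ i`. That leaves
-- at most 4 assignments for either, none visited twice.
theorem IsFlipPath.card_close_le {γ : ℕ → Config n} {ℓ : ℕ} (hγ : IsFlipPath γ ℓ) {u : Fin n}
    {Z : Finset ℕ} (hZ : ∀ t ∈ Z, t < ℓ ∧ u ∈ movedSet γ t) (i : ℕ) (hi : i ∈ Z) :
    (Z.filter fun j => ∀ x, x ∉ movedSet γ i → x ∉ movedSet γ j → γ i x = γ j x).card ≤ 8 := by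
  set C := Finset.univ.filter fun τ : Config n => ∀ x, x ∉ movedSet γ i → γ i x = τ x with hC
  have hC4 : C.card ≤ 4 := card_agree_outside_le _ _ (hγ.card_le i (hZ i hi).1)
  have hsub : (Z.filter fun j => ∀ x, x ∉ movedSet γ i → x ∉ movedSet γ j → γ i x = γ j x) ⊆
      (Z.filter fun j => γ j ∈ C) ∪ (Z.filter fun j => γ (j + 1) ∈ C) := by
    intro j
    simp only [Finset.mem_filter, Finset.mem_union, hC, Finset.mem_univ, true_and]
    rintro ⟨hj, h⟩
    by_contra! hcon
    obtain ⟨x, hx, hx'⟩ := hcon.1 hj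
    obtain ⟨y, hy, hy'⟩ := hcon.2 hj
    have hxj : x ∈ movedSet γ j := by
      by_contra hxj; exact hx' (h x hx hxj)
    have hyj : y ∈ movedSet γ j := by
      by_contra hyj
      exact hy' ((h y hy hyj).trans (notMem_movedSet.1 hyj))
    have hui := (hZ i hi).2
    have huj := (hZ j hj).2
    have hxy : x = y := by
      by_contra hxy
      have h3 : ({u, x, y} : Finset (Fin n)).card = 3 := by
        rw [Finset.card_eq_three]
        exact ⟨u, x, y, fun h => hx (h ▸ hui), fun h => hy (h ▸ hui), hxy, rfl⟩
      have h4 : ({u, x, y} : Finset (Fin n)) ⊆ movedSet γ j := by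
        intro z hz
        simp only [Finset.mem_insert, Finset.mem_singleton] at hz
        rcases hz with rfl | rfl | rfl <;> assumption
      have := (Finset.card_le_card h4).trans (hγ.card_le j (hZ j hj).1)
      omega
    subst hxy
    have := mem_movedSet.1 hxj
    revert hx' hy' this
    cases γ i x <;> cases γ j x <;> cases γ (j + 1) x <;> simp
  refine (Finset.card_le_card hsub).trans ((Finset.card_union_le _ _).trans ?_)
  have h1 : (Z.filter fun j => γ j ∈ C).card ≤ C.card := by
    refine Finset.card_le_card_of_injOn γ (fun j hj => (Finset.mem_filter.1 hj).2) ?_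
    intro s hs t ht h
    exact hγ.inj s (hZ s (Finset.mem_filter.1 hs).1).1.le t (hZ t (Finset.mem_filter.1 ht).1).1.le h
  have h2 : (Z.filter fun j => γ (j + 1) ∈ C).card ≤ C.card := by
    refine Finset.card_le_card_of_injOn (fun j => γ (j + 1))
      (fun j hj => (Finset.mem_filter.1 hj).2) ?_
    intro s hs t ht h
    have := hγ.inj (s + 1) (hZ s (Finset.mem_filter.1 hs).1).1 (t + 1)
      (hZ t (Finset.mem_filter.1 ht).1).1 h
    omega
  omega

/-- `1` or `-1` if the `t`-th step sets the variable `a` to `true` or `false`, and otherwise `0`. -/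
def flipSign (γ : ℕ → Config n) (t : ℕ) (a : Fin n) : ℤ :=
  if γ t a ≠ γ (t + 1) a then (if γ (t + 1) a then 1 else -1) else 0

theorem flipSign_eq_zero {γ : ℕ → Config n} {t : ℕ} {a : Fin n} (h : a ∉ movedSet γ t) :
    flipSign γ t a = 0 := by
  rw [notMem_movedSet] at h
  simp [flipSign, h]

theorem flipSign_ne_zero {γ : ℕ → Config n} {t : ℕ} {a : Fin n} (h : a ∈ movedSet γ t) :
    flipSign γ t a ≠ 0 := by
  rw [mem_movedSet] at h
  rw [flipSign, if_pos h]
  split <;> simp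

theorem abs_flipSign_le (γ : ℕ → Config n) (t : ℕ) (a : Fin n) : |flipSign γ t a| ≤ 1 := by
  unfold flipSign
  split_ifs <;> simp

/-- The coefficients of the weights in the change of the objective in the `t`-th step. -/
def BFOP.stepCoeff {m d : ℕ} (I : BFOP n m d) (γ : ℕ → Config n) (t : ℕ) (i : Fin m) : ℤ :=
  (I.f i (γ (t + 1) (I.fst i)) (γ (t + 1) (I.snd i)) : ℤ) -
    (I.f i (γ t (I.fst i)) (γ t (I.snd i)) : ℤ)

theorem separable_of_add_eq {f : Bool → Bool → ℕ}
    (h : (f true true : ℤ) - f false true = (f true false : ℤ) - f false false) :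
    Separable fun x y => (f x y : ℝ) := by
  have h' : (f true true : ℝ) - f false true = (f true false : ℝ) - f false false := by
    exact_mod_cast h
  refine ⟨fun x => f x false, fun y => f false y - f false false, fun x y => ?_⟩
  cases x <;> cases y <;> simp
  linarith

/-- While `x` stays fixed, a function of `u` and `x` changes by its discrete derivative in `u`. This
depends on the value of `x`, because a vanishing mixed difference means separability. -/
theorem BFOP.Complete.exists_index {m d : ℕ} {I : BFOP n m d} (hI : I.Complete) {u x : Fin n}
    (hux : u ≠ x) : ∃ (i : Fin m) (D : Bool → ℤ), D true ≠ D false ∧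
      ∀ (γ : ℕ → Config n) (t : ℕ), x ∉ movedSet γ t →
        I.stepCoeff γ t i = flipSign γ t u * D (γ t x) := by
  obtain ⟨i, hi, hs⟩ := hI u x hux
  rcases hi with ⟨h1, h2⟩ | ⟨h1, h2⟩
  · refine ⟨i, fun s => (I.f i true s : ℤ) - I.f i false s, fun h => hs (separable_of_add_eq h), ?_⟩
    intro γ t hx
    rw [notMem_movedSet] at hx
    simp only [stepCoeff, flipSign, h1, h2, ← hx]
    cases γ t u <;> cases γ (t + 1) u <;> simp
  · refine ⟨i, fun s => (I.f i s true : ℤ) - I.f i s false, fun h => hs (separable_of_add_eq ?_), ?_⟩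
    · linarith
    intro γ t hx
    rw [notMem_movedSet] at hx
    simp only [stepCoeff, flipSign, h1, h2, ← hx]
    cases γ t u <;> cases γ (t + 1) u <;> simp

theorem exists_subset_pair {S : Finset (Fin n)} (hS : S.card ≤ 2) {u : Fin n} (hu : u ∈ S) :
    ∃ v ∈ S, S ⊆ {u, v} := by
  by_cases h : ∃ v ∈ S, v ≠ u
  · obtain ⟨v, hv, hvu⟩ := h
    refine ⟨v, hv, (Finset.eq_of_subset_of_card_le ?_ ?_).ge⟩
    · intro z hz
      simp only [Finset.mem_insert, Finset.mem_singleton] at hz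
      rcases hz with rfl | rfl <;> assumption
    · rw [Finset.card_pair hvu.symm]; exact hS
  · push Not at h
    exact ⟨u, hu, fun z hz => by simp [h z hz]⟩

/-- The steps of a path with a dense set of variables give many independent linear forms. -/
theorem IsFlipPath.exists_independent_rows {m d : ℕ} {I : BFOP n m d} (hI : I.Complete)
    {γ : ℕ → Config n} {ℓ : ℕ} (hγ : IsFlipPath γ ℓ) {H : Finset (Fin n)}
    (hH : IsDense (movedSet γ) (2 ^ 57) (Finset.range ℓ) H) :
    ∃ (ι : Type) (_ : Fintype ι) (τ : ι → ℕ), 2 * H.card ≤ Fintype.card ι ∧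
      (∀ k, τ k < ℓ ∧ movedSet γ (τ k) ⊆ H) ∧
      LinearIndependent ℝ fun k => fun j : H ⊕ Fin m =>
        ((Sum.elim (fun a : H => flipSign γ (τ k) a) (fun i => I.stepCoeff γ (τ k) i) j : ℤ) : ℝ) := by
  classical
  -- `2 ^ 57 = 2 ^ (54 + 3)` occurrences yield 54 steps per variable; the colouring keeps at least
  -- one in 27, on average two per variable.
  have htri : ∀ u : H, ∃ (t : Fin 54 → ℕ) (x : Fin 54 → Fin n),
      (∀ j, t j < ℓ ∧ u.1 ∈ movedSet γ (t j) ∧ movedSet γ (t j) ⊆ H) ∧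
      (∀ j, x j ∉ movedSet γ (t j)) ∧ ∀ j l, j < l → γ (t l) (x j) ≠ γ (t j) (x j) := by
    intro u
    have hZ : ∀ t ∈ (Finset.range ℓ).filter fun t => u.1 ∈ movedSet γ t ∧ movedSet γ t ⊆ H,
        t < ℓ ∧ u.1 ∈ movedSet γ t ∧ movedSet γ t ⊆ H := fun t ht => by
      simpa only [Finset.mem_filter, Finset.mem_range] using ht
    obtain ⟨t, x, h1, h2, h3⟩ := exists_triangular γ (movedSet γ) 54 _
      (hH u.1 u.2) (fun i hi => by
        convert hγ.card_close_le (fun t ht => ⟨(hZ t ht).1, (hZ t ht).2.1⟩) i hi)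
    exact ⟨t, x, fun j => hZ _ (h1 j), h2, h3⟩
  choose t x ht hx hsep using htri
  have hpair : ∀ p : H × Fin 54, ∃ v ∈ movedSet γ (t p.1 p.2),
      movedSet γ (t p.1 p.2) ⊆ {p.1.1, v} := fun p =>
    exists_subset_pair (hγ.card_le _ (ht p.1 p.2).1) (ht p.1 p.2).2.1
  choose v hv hvsub using hpair
  have hxu : ∀ p : H × Fin 54, x p.1 p.2 ≠ p.1.1 := fun p h =>
    hx p.1 p.2 (h ▸ (ht p.1 p.2).2.1)
  have hxv : ∀ p : H × Fin 54, x p.1 p.2 ≠ v p := fun p h => hx p.1 p.2 (h ▸ hv p)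
  obtain ⟨c, hc⟩ := exists_coloring (fun p : H × Fin 54 => p.1.1) v (fun p => x p.1 p.2) hxu hxv
  -- Retained steps flip only colours 0 and 1, while witnesses have colour 2. So no retained step
  -- flips a retained witness, and `u` is flipped only in its own rows.
  have hcol : ∀ p p' : H × Fin 54,
      (c p.1.1 = 0 ∧ c (x p.1 p.2) = 2 ∧ (v p = p.1.1 ∨ c (v p) = 1)) →
      (c p'.1.1 = 0 ∧ c (x p'.1 p'.2) = 2 ∧ (v p' = p'.1.1 ∨ c (v p') = 1)) →
      x p.1 p.2 ∉ movedSet γ (t p'.1 p'.2) ∧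
        (p'.1 ≠ p.1 → p.1.1 ∉ movedSet γ (t p'.1 p'.2)) := by
    rintro p p' ⟨h1, h2, h3⟩ ⟨h1', h2', h3'⟩
    constructor
    · intro h
      have := hvsub p' h
      simp only [Finset.mem_insert, Finset.mem_singleton] at this
      rcases this with h | h
      · rw [h, h1'] at h2; exact absurd h2 (by decide)
      · rcases h3' with h3' | h3'
        · rw [h, h3', h1'] at h2; exact absurd h2 (by decide)
        · rw [h, h3'] at h2; exact absurd h2 (by decide)
    · intro hne h
      have hne' : p.1.1 ≠ p'.1.1 := fun h => hne (Subtype.ext h.symm)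
      have := hvsub p' h
      simp only [Finset.mem_insert, Finset.mem_singleton, hne', false_or] at this
      rcases h3' with h3' | h3'
      · exact hne' (this.trans h3')
      · rw [this, h3'] at h1; exact absurd h1 (by decide)
  refine ⟨{p : H × Fin 54 // c p.1.1 = 0 ∧ c (x p.1 p.2) = 2 ∧ (v p = p.1.1 ∨ c (v p) = 1)},
    inferInstance, fun k => t k.1.1 k.1.2, ?_, fun k => ⟨(ht _ _).1, (ht _ _).2.2⟩, ?_⟩
  · rw [Fintype.card_subtype]
    rw [Fintype.card_prod, Fintype.card_fin, Fintype.card_coe] at hc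
    omega
  · rw [Fintype.linearIndependent_iff]
    intro g hg
    have key : ∀ (N : ℕ) (k : {p : H × Fin 54 // c p.1.1 = 0 ∧ c (x p.1 p.2) = 2 ∧
        (v p = p.1.1 ∨ c (v p) = 1)}), k.1.2.1 = N → g k = 0 := by
      intro N
      induction N using Nat.strong_induction_on with
      | _ N ih =>
      rintro k rfl
      obtain ⟨i, D, hD, hi⟩ := hI.exists_index (hxu k.1).symm
      have e1 := congrFun hg (Sum.inr i)
      have e2 := congrFun hg (Sum.inl k.1.1)
      simp only [Finset.sum_apply, Pi.smul_apply, smul_eq_mul, Sum.elim_inl, Sum.elim_inr,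
        Pi.zero_apply] at e1 e2
      set b := γ (t k.1.1 k.1.2) (x k.1.1 k.1.2) with hb
      -- Subtracting `D (!b)` times the column of `u` from the weight column kills the rows where
      -- the witness has value `!b`, among them all later rows of `u`. Rows of other variables
      -- vanish, and earlier rows of `u` have coefficient 0 by induction.
      have e3 : ∑ k', g k' * ((flipSign γ (t k'.1.1 k'.1.2) k.1.1 : ℝ) *
          ((D (γ (t k'.1.1 k'.1.2) (x k.1.1 k.1.2)) : ℝ) - D (!b))) = 0 := by
        have : ∀ k', g k' * ((flipSign γ (t k'.1.1 k'.1.2) k.1.1 : ℝ) *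
            ((D (γ (t k'.1.1 k'.1.2) (x k.1.1 k.1.2)) : ℝ) - D (!b))) =
            g k' * (I.stepCoeff γ (t k'.1.1 k'.1.2) i : ℝ) -
              D (!b) * (g k' * (flipSign γ (t k'.1.1 k'.1.2) k.1.1 : ℝ)) := by
          intro k'
          rw [hi γ _ (hcol k.1 k'.1 k.2 k'.2).1]
          push_cast
          ring
        simp_rw [this]
        rw [Finset.sum_sub_distrib, ← Finset.mul_sum, e1, e2]
        simp
      rw [Finset.sum_eq_single k] at e3
      · have h1 : (flipSign γ (t k.1.1 k.1.2) k.1.1 : ℝ) ≠ 0 := by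
          exact_mod_cast flipSign_ne_zero (ht k.1.1 k.1.2).2.1
        have h2 : (D b : ℝ) - D (!b) ≠ 0 := by
          rw [sub_ne_zero]
          have : D b ≠ D (!b) := by
            cases b
            · exact hD.symm
            · exact hD
          exact_mod_cast this
        rw [← hb] at e3
        exact (mul_eq_zero.1 e3).resolve_right (mul_ne_zero h1 h2)
      · intro k' _ hne
        by_cases hu : k'.1.1 = k.1.1
        · rcases lt_trichotomy k'.1.2 k.1.2 with h | h | h
          · rw [ih _ h k' rfl, zero_mul]
          · exact absurd (Subtype.ext (Prod.ext hu h)) hne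
          · have h3 := hsep k.1.1 _ _ h
            rw [← hu, hu, ← hb] at h3
            have : γ (t k'.1.1 k'.1.2) (x k.1.1 k.1.2) = !b := by
              rw [hu]
              exact Bool.eq_not.2 h3
            rw [this, sub_self, mul_zero, mul_zero]
        · rw [flipSign_eq_zero ((hcol k.1 k'.1 k.2 k'.2).2 hu)]
          simp
      · simp
    exact fun k => key _ k rfl

/-- It is unlikely that all steps of a path with a dense set of variables change the objective
by little, up to unknown fields on the variables. -/
theorem IsFlipPath.pi_le {m d : ℕ} {I : BFOP n m d} (hI : I.Complete) (hn : 0 < n)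
    {γ : ℕ → Config n} {ℓ : ℕ} (hγ : IsFlipPath γ ℓ) {H : Finset (Fin n)}
    (hH : IsDense (movedSet γ) (2 ^ 57) (Finset.range ℓ) H) (μ : Fin m → Measure ℝ)
    [∀ i, IsProbabilityMeasure (μ i)] (φ ε : ℝ) (hφ : 0 < φ) (hε : 0 < ε)
    (hμ : ∀ i, μ i ≤ φ.toNNReal • volume) (hsmall : 8 * n * ε * φ ≤ 1) :
    Measure.pi μ {w | ∃ h : Fin n → ℝ, ∀ t < ℓ, |∑ a, (flipSign γ t a : ℝ) * h a +
      ∑ i, (I.stepCoeff γ t i : ℝ) * w i| ≤ ε} ≤ ENNReal.ofReal ((8 * n * ε * φ) ^ H.card) := by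
  obtain ⟨ι, _, τ, hcard, hτ, hind⟩ := hγ.exists_independent_rows hI hH
  have := pi_exists_abs_le (fun k => Sum.elim (fun a : H => flipSign γ (τ k) a)
    (fun i => I.stepCoeff γ (τ k) i)) hind (fun k a => abs_flipSign_le _ _ _)
    (by rwa [Fintype.card_coe]) n hn (by
      rw [Fintype.card_coe]; simpa using Finset.card_le_univ H) μ φ ε hφ hε hμ hsmall
  rw [Fintype.card_coe] at this
  refine (measure_mono ?_).trans this
  rintro w ⟨h, hw⟩
  refine ⟨fun a => h a, fun k => ?_⟩
  have h1 := hw (τ k) (hτ k).1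
  simp only [Sum.elim_inl, Sum.elim_inr]
  convert h1 using 3
  rw [Finset.sum_coe_sort H fun a => (flipSign γ (τ k) a : ℝ) * h a]
  -- The selected steps flip only variables of `H`, so fields elsewhere do not enter.
  refine Finset.sum_subset (Finset.subset_univ _) fun a _ ha => ?_
  rw [flipSign_eq_zero fun h => ha ((hτ k).2 h)]
  simp

end Paths

/-! ### Masked windows, the union bound and slow stretches -/

section Windows

variable {n : ℕ}

/-- The window of length `ℓ` of the sequence `γ` that starts at time `a`, with all variables that
are not flipped in it reset to `false`. -/
noncomputable def maskedWindow (γ : ℕ → Config n) (a ℓ : ℕ) : ℕ → Config n := fun t x =>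
  open Classical in
  if ∃ s < ℓ, x ∈ movedSet γ (a + s) then γ (a + min t ℓ) x else false

theorem movedSet_maskedWindow (γ : ℕ → Config n) (a ℓ : ℕ) {t : ℕ} (ht : t < ℓ) :
    movedSet (maskedWindow γ a ℓ) t = movedSet γ (a + t) := by
  ext x
  rw [mem_movedSet, mem_movedSet]
  have e1 : min t ℓ = t := by omega
  have e2 : min (t + 1) ℓ = t + 1 := by omega
  by_cases h : ∃ s < ℓ, x ∈ movedSet γ (a + s)
  · simp only [maskedWindow, if_pos h, e1, e2, ← add_assoc]
  · simp only [maskedWindow, if_neg h, ne_eq, not_true_eq_false, false_iff, not_not]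
    push Not at h
    exact notMem_movedSet.1 (h t ht)

theorem eq_of_forall_notMem_movedSet {γ : ℕ → Config n} {a ℓ : ℕ} {x : Fin n}
    (h : ¬ ∃ s < ℓ, x ∈ movedSet γ (a + s)) {t : ℕ} (ht : t ≤ ℓ) : γ (a + t) x = γ a x := by
  push Not at h
  induction t with
  | zero => rfl
  | succ t ih =>
    rw [← ih (by omega), ← add_assoc]
    exact (notMem_movedSet.1 (h t (by omega))).symm

theorem isFlipPath_maskedWindow {γ : ℕ → Config n} {L a ℓ : ℕ} (hγ : IsFlipPath γ L)
    (h : a + ℓ ≤ L) : IsFlipPath (maskedWindow γ a ℓ) ℓ := by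
  refine ⟨fun t ht => ?_, fun s hs t ht hst => ?_⟩
  · rw [movedSet_maskedWindow γ a ℓ ht]
    exact hγ.card_le _ (by omega)
  · have : γ (a + s) = γ (a + t) := by
      funext x
      by_cases hx : ∃ s < ℓ, x ∈ movedSet γ (a + s)
      · have := congrFun hst x
        simpa only [maskedWindow, if_pos hx, min_eq_left hs, min_eq_left ht] using this
      · rw [eq_of_forall_notMem_movedSet hx hs, eq_of_forall_notMem_movedSet hx ht]
    have := hγ.inj _ (by omega) _ (by omega) this
    omega

theorem isDense_maskedWindow {γ : ℕ → Config n} {K a ℓ : ℕ} {H : Finset (Fin n)}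
    (hH : IsDense (movedSet γ) K (Finset.Ico a (a + ℓ)) H) :
    IsDense (movedSet (maskedWindow γ a ℓ)) K (Finset.range ℓ) H := by
  intro u hu
  refine (hH u hu).trans (Finset.card_le_card_of_injOn (fun t => t - a) ?_ ?_)
  · intro t ht
    simp only [Finset.coe_filter, Finset.mem_Ico, Set.mem_ofPred_eq, Finset.mem_range] at ht ⊢
    rw [movedSet_maskedWindow _ _ _ (by omega), Nat.add_sub_of_le ht.1.1]
    exact ⟨by omega, ht.2⟩
  · intro s hs t ht hst
    simp only [Finset.coe_filter, Finset.mem_Ico, Set.mem_ofPred_eq] at hs ht hst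
    omega

/-- Paths of length `ℓ` in which the variables that are never flipped are `false`. -/
structure IsMasked (σ : ℕ → Config n) (ℓ : ℕ) : Prop where
  eq_min : ∀ t, σ t = σ (min t ℓ)
  eq_false : ∀ x, (∀ s < ℓ, x ∉ movedSet σ s) → ∀ t, σ t x = false
  exists_pair : ∀ t < ℓ, ∃ u v, movedSet σ t = {u, v}

theorem exists_eq_pair {S : Finset (Fin n)} (hS : S.card ≤ 2) (hne : S.Nonempty) :
    ∃ u v, S = {u, v} := by
  obtain ⟨u, hu⟩ := hne
  obtain ⟨v, hv, hsub⟩ := exists_subset_pair hS hu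
  refine ⟨u, v, hsub.antisymm fun z hz => ?_⟩
  simp only [Finset.mem_insert, Finset.mem_singleton] at hz
  rcases hz with rfl | rfl <;> assumption

theorem isMasked_maskedWindow {γ : ℕ → Config n} {a ℓ : ℕ}
    (hc : ∀ t < ℓ, (movedSet γ (a + t)).card ≤ 2) (hne : ∀ t < ℓ, (movedSet γ (a + t)).Nonempty) :
    IsMasked (maskedWindow γ a ℓ) ℓ := by
  refine ⟨fun t => ?_, fun x hx t => ?_, fun t ht => ?_⟩
  · funext x
    simp [maskedWindow]
  · refine if_neg ?_
    rintro ⟨s, hs, h⟩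
    exact hx s hs (by rwa [movedSet_maskedWindow _ _ _ hs])
  · rw [movedSet_maskedWindow _ _ _ ht]
    exact exists_eq_pair (hc t ht) (hne t ht)

/-- Masked paths can be encoded by the flipped variables and their values when flipped. -/
theorem exists_injOn_code (hn : 0 < n) (ℓ : ℕ) :
    ∃ enc : (ℕ → Config n) → (Fin ℓ → (Fin n × Fin n) × (Bool × Bool)),
      Set.InjOn enc {σ | IsMasked σ ℓ} := by
  classical
  have h : ∀ σ : ℕ → Config n, ∃ e : Fin ℓ → (Fin n × Fin n) × (Bool × Bool), IsMasked σ ℓ →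
      ∀ t : Fin ℓ, movedSet σ t = {(e t).1.1, (e t).1.2} ∧ (e t).2 = (σ t (e t).1.1, σ t (e t).1.2) := by
    intro σ
    by_cases hσ : IsMasked σ ℓ
    · choose u v huv using fun t : Fin ℓ => hσ.exists_pair t t.2
      exact ⟨fun t => ((u t, v t), (σ t (u t), σ t (v t))), fun _ t => ⟨huv t, rfl⟩⟩
    · exact ⟨fun _ => ((⟨0, hn⟩, ⟨0, hn⟩), (true, true)), fun h => absurd h hσ⟩
  choose enc henc using h
  refine ⟨enc, fun σ hσ σ' hσ' heq => ?_⟩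
  have hm : ∀ t < ℓ, movedSet σ t = movedSet σ' t := fun t ht => by
    rw [(henc σ hσ ⟨t, ht⟩).1, (henc σ' hσ' ⟨t, ht⟩).1, heq]
  have hv : ∀ t < ℓ, ∀ x ∈ movedSet σ t, σ t x = σ' t x := by
    intro t ht x hx
    have h1 := (henc σ hσ ⟨t, ht⟩).2
    have h2 := (henc σ' hσ' ⟨t, ht⟩).2
    rw [heq, h2, Prod.mk.injEq] at h1
    rw [(henc σ hσ ⟨t, ht⟩).1, heq] at hx
    simp only [Finset.mem_insert, Finset.mem_singleton] at hx
    rcases hx with rfl | rfl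
    · exact h1.1.symm
    · exact h1.2.symm
  have hle : ∀ t ≤ ℓ, ∀ x, σ t x = σ' t x := by
    intro t ht x
    by_cases hx : ∃ s < ℓ, x ∈ movedSet σ s
    · obtain ⟨s, hs, hxs⟩ := hx
      -- Paths that flip `x` at the same times agree at `x` always or never, so one recorded value
      -- decides.
      have hiff : ∀ t ≤ ℓ, (σ t x = σ' t x ↔ σ 0 x = σ' 0 x) := by
        intro t
        induction t with
        | zero => simp
        | succ t ih =>
          intro ht
          rw [← ih (by omega)]
          have h1 : x ∈ movedSet σ t ↔ x ∈ movedSet σ' t := by rw [hm t (by omega)]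
          rw [mem_movedSet, mem_movedSet] at h1
          revert h1
          cases σ t x <;> cases σ' t x <;> cases σ (t + 1) x <;> cases σ' (t + 1) x <;> simp
      exact (hiff t ht).2 ((hiff s hs.le).1 (hv s hs x hxs))
    · push Not at hx
      rw [hσ.eq_false x hx, hσ'.eq_false x fun s hs => by rw [← hm s hs]; exact hx s hs]
  funext t x
  rw [hσ.eq_min, hσ'.eq_min]
  exact hle _ (min_le_right _ _) x

/-- A union bound over masked paths. -/
theorem measure_biUnion_masked_le {Ω : Type*} [MeasurableSpace Ω] (P : Measure Ω) (hn : 0 < n) (ℓ : ℕ)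
    (s : Set (ℕ → Config n)) (hs : ∀ σ ∈ s, IsMasked σ ℓ) (E : (ℕ → Config n) → Set Ω)
    (b : ENNReal) (hE : ∀ σ ∈ s, P (E σ) ≤ b) :
    P (⋃ σ ∈ s, E σ) ≤ (4 * n ^ 2) ^ ℓ * b := by
  obtain ⟨enc, henc⟩ := exists_injOn_code hn ℓ
  have hsub : (⋃ σ ∈ s, E σ) ⊆ ⋃ q, ⋃ σ ∈ {σ ∈ s | enc σ = q}, E σ := by
    intro w hw
    simp only [Set.mem_iUnion] at hw ⊢
    obtain ⟨σ, hσ, h⟩ := hw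
    exact ⟨enc σ, σ, ⟨hσ, rfl⟩, h⟩
  refine (measure_mono hsub).trans ((measure_iUnion_fintype_le _ _).trans ?_)
  refine (Finset.sum_le_sum (g := fun _ => b) fun q _ => ?_).trans ?_
  -- Each code belongs to at most one path of `s`, so its union is a single event or empty.
  · rcases Set.eq_empty_or_nonempty {σ ∈ s | enc σ = q} with h | ⟨σ, hσ, hq⟩
    · simp [h]
    · refine (measure_mono ?_).trans (hE σ hσ)
      intro w hw
      simp only [Set.mem_iUnion] at hw
      obtain ⟨σ', ⟨hσ', hq'⟩, h⟩ := hw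
      rwa [henc (hs σ hσ) (hs σ' hσ') (hq.trans hq'.symm)]
  · rw [Finset.sum_const, Finset.card_univ, nsmul_eq_mul]
    refine le_of_eq ?_
    congr 1
    simp only [Fintype.card_fun, Fintype.card_prod, Fintype.card_fin, Fintype.card_bool]
    push_cast
    congr 1
    ring

theorem flipSign_maskedWindow (γ : ℕ → Config n) (a ℓ : ℕ) {t : ℕ} (ht : t < ℓ) (x : Fin n) :
    flipSign (maskedWindow γ a ℓ) t x = flipSign γ (a + t) x := by
  by_cases hx : x ∈ movedSet γ (a + t)
  · have h : ∃ s < ℓ, x ∈ movedSet γ (a + s) := ⟨t, ht, hx⟩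
    have e1 : min t ℓ = t := by omega
    have e2 : min (t + 1) ℓ = t + 1 := by omega
    simp only [flipSign, maskedWindow, if_pos h, e1, e2, ← add_assoc]
  · rw [flipSign_eq_zero hx, flipSign_eq_zero]
    rwa [movedSet_maskedWindow _ _ _ ht]

variable {m d : ℕ} (I : BFOP n m d)

/-- Resetting the variables that are not flipped changes the linear forms only by fields. -/
theorem BFOP.exists_field_stepCoeff (γ : ℕ → Config n) (a ℓ : ℕ) (i : Fin m) :
    ∃ c : Fin n → ℤ, ∀ t < ℓ, I.stepCoeff γ (a + t) i =
      ∑ x, flipSign (maskedWindow γ a ℓ) t x * c x + I.stepCoeff (maskedWindow γ a ℓ) t i := by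
  classical
  have e1 : ∀ t < ℓ, min t ℓ = t := fun t ht => by omega
  have e2 : ∀ t < ℓ, min (t + 1) ℓ = t + 1 := fun t ht => by omega
  by_cases hf : ∃ s < ℓ, I.fst i ∈ movedSet γ (a + s) <;>
  by_cases hs : ∃ s < ℓ, I.snd i ∈ movedSet γ (a + s)
  · refine ⟨0, fun t ht => ?_⟩
    simp [stepCoeff, maskedWindow, if_pos hf, if_pos hs, e1 t ht, e2 t ht, ← add_assoc]
  -- Only the first argument moves. Resetting the frozen second argument replaces one discrete
  -- derivative by another, and their constant difference is the field at `I.fst i`.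
  · refine ⟨fun x => if I.fst i = x then
      ((I.f i true (γ a (I.snd i)) : ℤ) - I.f i false (γ a (I.snd i))) -
      ((I.f i true false : ℤ) - I.f i false false) else 0, fun t ht => ?_⟩
    simp only [mul_ite, mul_zero, Finset.sum_ite_eq, Finset.mem_univ, if_true]
    rw [flipSign_maskedWindow _ _ _ ht]
    have h1 := eq_of_forall_notMem_movedSet hs ht.le
    have h2 := eq_of_forall_notMem_movedSet hs (Nat.succ_le_of_lt ht)
    rw [Nat.succ_eq_add_one, ← add_assoc] at h2
    simp only [stepCoeff, maskedWindow, if_pos hf, if_neg hs, e1 t ht, e2 t ht, ← add_assoc, h1,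
      h2, flipSign]
    cases γ (a + t) (I.fst i) <;> cases γ (a + t + 1) (I.fst i) <;> simp
    ring
  · refine ⟨fun x => if I.snd i = x then
      ((I.f i (γ a (I.fst i)) true : ℤ) - I.f i (γ a (I.fst i)) false) -
      ((I.f i false true : ℤ) - I.f i false false) else 0, fun t ht => ?_⟩
    simp only [mul_ite, mul_zero, Finset.sum_ite_eq, Finset.mem_univ, if_true]
    rw [flipSign_maskedWindow _ _ _ ht]
    have h1 := eq_of_forall_notMem_movedSet hf ht.le
    have h2 := eq_of_forall_notMem_movedSet hf (Nat.succ_le_of_lt ht)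
    rw [Nat.succ_eq_add_one, ← add_assoc] at h2
    simp only [stepCoeff, maskedWindow, if_pos hs, if_neg hf, e1 t ht, e2 t ht, ← add_assoc, h1,
      h2, flipSign]
    cases γ (a + t) (I.snd i) <;> cases γ (a + t + 1) (I.snd i) <;> simp
    ring
  · refine ⟨0, fun t ht => ?_⟩
    have h1 := eq_of_forall_notMem_movedSet hs ht.le
    have h2 := eq_of_forall_notMem_movedSet hs (Nat.succ_le_of_lt ht)
    have h3 := eq_of_forall_notMem_movedSet hf ht.le
    have h4 := eq_of_forall_notMem_movedSet hf (Nat.succ_le_of_lt ht)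
    rw [Nat.succ_eq_add_one, ← add_assoc] at h2 h4
    simp [stepCoeff, maskedWindow, if_neg hf, if_neg hs, h1, h2, h3, h4]

theorem BFOP.obj_succ_sub (w : Fin m → ℝ) (γ : ℕ → Config n) (t : ℕ) :
    I.obj w (γ (t + 1)) - I.obj w (γ t) = ∑ i, (I.stepCoeff γ t i : ℝ) * w i := by
  simp only [obj, stepCoeff]
  rw [← Finset.sum_sub_distrib]
  refine Finset.sum_congr rfl fun i _ => ?_
  push_cast
  ring

/-- The field depends on the weights and on the erased values, which is why the anti-concentration
bound quantifies over all `h` inside the event. -/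
theorem BFOP.exists_field (w : Fin m → ℝ) (γ : ℕ → Config n) (a ℓ : ℕ) :
    ∃ h : Fin n → ℝ, ∀ t < ℓ, ∑ x, (flipSign (maskedWindow γ a ℓ) t x : ℝ) * h x +
      ∑ i, (I.stepCoeff (maskedWindow γ a ℓ) t i : ℝ) * w i =
      I.obj w (γ (a + t + 1)) - I.obj w (γ (a + t)) := by
  choose c hc using I.exists_field_stepCoeff γ a ℓ
  refine ⟨fun x => ∑ i, (c i x : ℝ) * w i, fun t ht => ?_⟩
  rw [I.obj_succ_sub]
  simp_rw [hc _ t ht]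
  push_cast
  simp_rw [add_mul, Finset.sum_add_distrib, Finset.sum_mul, Finset.mul_sum]
  rw [Finset.sum_comm]
  simp_rw [mul_assoc]

/-- The weights for which some `L` improving steps together improve the objective by at most
`ε`. -/
def BFOP.slowWeights (L : ℕ) (ε : ℝ) : Set (Fin m → ℝ) :=
  {w | ∃ γ : ℕ → Config n, (∀ t < L, hammingDist (γ t) (γ (t + 1)) ≤ 2 ∧
    I.obj w (γ t) < I.obj w (γ (t + 1))) ∧ I.obj w (γ L) - I.obj w (γ 0) ≤ ε}

variable {I}

theorem BFOP.pi_slowWeights_le (hI : I.Complete) (hn : 0 < n) {D : ℕ}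
    (hD : 2 * 2 ^ 57 * n < 2 ^ D) (μ : Fin m → Measure ℝ) [∀ i, IsProbabilityMeasure (μ i)]
    (φ ε : ℝ) (hφ : 0 < φ) (hε : 0 < ε) (hμ : ∀ i, μ i ≤ φ.toNNReal • volume)
    (hsmall : 8 * n * ε * φ = (1 / (4 * n ^ 4)) ^ (4 * 2 ^ 57 * D)) :
    Measure.pi μ (I.slowWeights (2 ^ D) ε) ≤ ENNReal.ofReal ((D + 1) * (1 / n ^ 2)) := by
  have hn1 : (1 : ℝ) ≤ n := by exact_mod_cast hn
  have hn4 : (1 : ℝ) ≤ n ^ 4 := one_le_pow₀ hn1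
  have hρ0 : (0 : ℝ) < 1 / (4 * n ^ 4) := by positivity
  have hρ1 : (1 : ℝ) / (4 * n ^ 4) ≤ 1 := by
    rw [div_le_one (by positivity)]; linarith
  let s : ℕ → Set (ℕ → Config n) := fun j => {σ | IsMasked σ (2 ^ j) ∧ IsFlipPath σ (2 ^ j) ∧
    ∃ H, IsDense (movedSet σ) (2 ^ 57) (Finset.range (2 ^ j)) H ∧ 2 ^ j ≤ 4 * 2 ^ 57 * D * H.card}
  let E : ℕ → (ℕ → Config n) → Set (Fin m → ℝ) := fun j σ =>
    {w | ∃ h : Fin n → ℝ, ∀ t < 2 ^ j, |∑ a, (flipSign σ t a : ℝ) * h a +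
      ∑ i, (I.stepCoeff σ t i : ℝ) * w i| ≤ ε}
  have hsub : I.slowWeights (2 ^ D) ε ⊆ ⋃ j ∈ Finset.range (D + 1), ⋃ σ ∈ s j, E j σ := by
    rintro w ⟨γ, hγ, hle⟩
    have hmono : ∀ b ≤ 2 ^ D, ∀ a ≤ b, I.obj w (γ a) ≤ I.obj w (γ b) := by
      intro b
      induction b with
      | zero => intro _ a ha; rw [Nat.le_zero.1 ha]
      | succ b ih =>
        intro hb a ha
        rcases Nat.lt_or_ge a (b + 1) with h | h
        · exact (ih (by omega) a (by omega)).trans (hγ b (by omega)).2.le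
        · rw [le_antisymm ha h]
    have hstrict : ∀ a b, a < b → b ≤ 2 ^ D → I.obj w (γ a) < I.obj w (γ b) := fun a b hab hb =>
      (hγ a (by omega)).2.trans_le (hmono b hb (a + 1) hab)
    have hpath : IsFlipPath γ (2 ^ D) := by
      refine ⟨fun t ht => (hγ t ht).1, fun a ha b hb hab => ?_⟩
      rcases lt_trichotomy a b with h | h | h
      · exact absurd (hstrict a b h hb) (by rw [hab]; exact lt_irrefl _)
      · exact h
      · exact absurd (hstrict b a h ha) (by rw [hab]; exact lt_irrefl _)
    have hne : ∀ t < 2 ^ D, (movedSet γ t).Nonempty := by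
      intro t ht
      by_contra h
      rw [Finset.not_nonempty_iff_eq_empty] at h
      have : γ t = γ (t + 1) := funext fun x => notMem_movedSet.1 (by simp [h])
      exact absurd (hγ t ht).2 (by rw [← this]; exact lt_irrefl _)
    obtain ⟨a, j, hj, haj, hcore⟩ := exists_window_denseCore (movedSet γ) (2 ^ 57) D (by norm_num)
      hne (by simpa using hD)
    simp only [Set.mem_iUnion]
    refine ⟨j, Finset.mem_range.2 (by omega), maskedWindow γ a (2 ^ j),
      ⟨isMasked_maskedWindow (fun t ht => hpath.card_le _ (by omega))
        (fun t ht => hne _ (by omega)), isFlipPath_maskedWindow hpath haj, _,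
        isDense_maskedWindow (isDense_denseCore _ _ _), hcore⟩, ?_⟩
    obtain ⟨h, hh⟩ := I.exists_field w γ a (2 ^ j)
    refine ⟨h, fun t ht => ?_⟩
    rw [hh t ht, abs_of_pos (sub_pos.2 (hγ _ (by omega)).2)]
    have h1 := hmono (2 ^ D) le_rfl (a + t + 1) (by omega)
    have h2 := hmono (a + t) (by omega) 0 (by omega)
    linarith
  refine (measure_mono hsub).trans ((measure_biUnion_finset_le _ _).trans ?_)
  have hj : ∀ j ∈ Finset.range (D + 1), Measure.pi μ (⋃ σ ∈ s j, E j σ) ≤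
      ENNReal.ofReal (1 / n ^ 2) := by
    intro j _
    -- For length `2 ^ j` the union bound gives `((4 * n ^ 2) * (1 / (4 * n ^ 4))) ^ 2 ^ j`, which
    -- is at most `1 / n ^ 2`.
    refine (measure_biUnion_masked_le _ hn (2 ^ j) (s j) (fun σ hσ => hσ.1) (E j)
      (ENNReal.ofReal ((1 / (4 * n ^ 4)) ^ 2 ^ j)) ?_).trans ?_
    · rintro σ ⟨-, hσ, H, hH, hc⟩
      refine (hσ.pi_le hI hn hH μ φ ε hφ hε hμ ?_).trans (ENNReal.ofReal_le_ofReal ?_)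
      · rw [hsmall]; exact pow_le_one₀ hρ0.le hρ1
      · rw [hsmall, ← pow_mul]
        exact pow_le_pow_of_le_one hρ0.le hρ1 hc
    · have e : ((4 : ENNReal) * n ^ 2) ^ 2 ^ j = ENNReal.ofReal ((4 * n ^ 2) ^ 2 ^ j) := by
        rw [ENNReal.ofReal_pow (by positivity), ENNReal.ofReal_mul (by norm_num),
          ENNReal.ofReal_pow (by positivity)]
        simp
      rw [e, ← ENNReal.ofReal_mul (by positivity), ← mul_pow]
      refine ENNReal.ofReal_le_ofReal ?_
      have e' : (4 * (n : ℝ) ^ 2) * (1 / (4 * n ^ 4)) = 1 / n ^ 2 := by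
        field_simp
      rw [e']
      refine pow_le_of_le_one (by positivity) ?_ (by positivity)
      rw [div_le_one (by positivity)]
      exact one_le_pow₀ hn1
  refine (Finset.sum_le_sum hj).trans ?_
  rw [Finset.sum_const, Finset.card_range, nsmul_eq_mul, ENNReal.ofReal_mul (by positivity)]
  gcongr
  rw [← Nat.cast_add_one, ENNReal.ofReal_natCast]

theorem BFOP.abs_obj_le (w : Fin m → ℝ) (hw : ∀ i, |w i| ≤ 1) (γ : Config n) :
    |I.obj w γ| ≤ m * d := by
  refine (Finset.abs_sum_le_sum_abs _ _).trans ?_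
  calc _ ≤ ∑ _i : Fin m, (d : ℝ) := by
        refine Finset.sum_le_sum fun i _ => ?_
        rw [abs_mul, Nat.abs_cast]
        have : (I.f i (γ (I.fst i)) (γ (I.snd i)) : ℝ) ≤ d := by exact_mod_cast I.f_le _ _ _
        calc _ ≤ 1 * (d : ℝ) := mul_le_mul (hw i) this (by positivity) (by norm_num)
          _ = d := one_mul _
    _ = _ := by simp

theorem BFOP.twoFlipTerminatesWithin (w : Fin m → ℝ) (hw : ∀ i, |w i| ≤ 1) {L : ℕ} {ε T : ℝ}
    (hε : 0 < ε) (hslow : w ∉ I.slowWeights L ε) (hT : L * (2 * (m * d) / ε + 1) ≤ T) :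
    I.TwoFlipTerminatesWithin w T := by
  intro γ hγ
  by_contra! hno
  -- `q` blocks of `L` steps, each gaining more than `ε`, would exceed the range `2 * m * d` of the
  -- objective.
  set q := ⌊2 * ((m : ℝ) * d) / ε⌋₊ + 1 with hq
  have hqT : ((q * L : ℕ) : ℝ) ≤ T := by
    refine le_trans ?_ hT
    have h1 : (⌊2 * ((m : ℝ) * d) / ε⌋₊ : ℝ) ≤ 2 * (m * d) / ε :=
      Nat.floor_le (by positivity)
    rw [hq]
    push_cast
    rw [mul_comm]
    gcongr
  have hstep : ∀ t ≤ q * L, I.TwoFlipStep w (γ t) (γ (t + 1)) := fun t ht =>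
    hγ t (hno t (le_trans (by exact_mod_cast ht) hqT))
  have hblock : ∀ k < q, I.obj w (γ (k * L)) + ε < I.obj w (γ ((k + 1) * L)) := by
    intro k hk
    by_contra! h
    refine hslow ⟨fun t => γ (k * L + t), fun t ht => ?_, ?_⟩
    · have : k * L + t ≤ q * L := by
        have : (k + 1) * L ≤ q * L := Nat.mul_le_mul_right _ hk
        rw [add_mul] at this
        omega
      exact ⟨(hstep _ this).1, (hstep _ this).2.1⟩
    · rw [add_mul, one_mul] at h
      simp only [add_zero]
      linarith
  have hsum : ∀ k ≤ q, I.obj w (γ 0) + k * ε ≤ I.obj w (γ (k * L)) := by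
    intro k
    induction k with
    | zero => simp
    | succ k ih =>
      intro hk
      have h1 := ih (by omega)
      have h2 := hblock k hk
      push_cast
      linarith
  have h1 := hsum q le_rfl
  have h2 := abs_le.1 (abs_obj_le (I := I) w hw (γ 0))
  have h3 := abs_le.1 (abs_obj_le (I := I) w hw (γ (q * L)))
  have h4 : 2 * ((m : ℝ) * d) / ε < q := by
    rw [hq]; push_cast; exact Nat.lt_floor_add_one _
  rw [div_lt_iff₀ hε] at h4
  linarith [h2.1, h3.2]

end Windows

/-! ### Choice of parameters and the final bound -/

section Main

theorem IsSmoothedWeight.le_smul_volume {φ : ℝ} {μ : Measure ℝ} (h : IsSmoothedWeight φ μ) :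
    μ ≤ φ.toNNReal • volume := by
  obtain ⟨-, -, g, -, hg, rfl⟩ := h
  calc _ ≤ (volume : Measure ℝ).withDensity fun _ => ENNReal.ofReal φ :=
        withDensity_mono (Eventually.of_forall hg)
    _ = ENNReal.ofReal φ • volume := withDensity_const _
    _ = _ := rfl

/-- Mass 1 sits on an interval of length 2. The bound lets the additive 1 in the step count be
absorbed into `m * φ`. -/
theorem IsSmoothedWeight.half_le {φ : ℝ} {μ : Measure ℝ} (h : IsSmoothedWeight φ μ) :
    1 / 2 ≤ φ := by
  have h1 := h.le_smul_volume (Set.Icc (-1) 1)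
  rw [h.2.1, Measure.smul_apply, Real.volume_Icc, ENNReal.smul_def, smul_eq_mul] at h1
  change 1 ≤ ENNReal.ofReal φ * _ at h1
  rw [← ENNReal.ofReal_mul' (by norm_num), ENNReal.one_le_ofReal] at h1
  linarith

theorem pi_forall_abs_le_one {m : ℕ} {φ : ℝ} {μ : Fin m → Measure ℝ}
    (h : ∀ i, IsSmoothedWeight φ (μ i)) [∀ i, IsProbabilityMeasure (μ i)] :
    Measure.pi μ {w | ∀ i, |w i| ≤ 1}ᶜ = 0 := by
  have e : {w : Fin m → ℝ | ∀ i, |w i| ≤ 1} = Set.univ.pi fun _ => Set.Icc (-1) 1 := by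
    ext w
    simp only [Set.mem_ofPred_eq, Set.mem_pi, Set.mem_univ, true_imp_iff, Set.mem_Icc, abs_le]
  have hm : MeasurableSet (Set.univ.pi fun _ : Fin m => Set.Icc (-1 : ℝ) 1) :=
    MeasurableSet.univ_pi fun _ => measurableSet_Icc
  rw [e, prob_compl_eq_zero_iff hm, Measure.pi_pi]
  exact Finset.prod_eq_one fun i _ => (h i).2.1

/-- The step bound obtained from windows of length `2 ^ D`. -/
theorem step_bound_le {n m d D A k : ℕ} {φ : ℝ} (hn : 2 ^ 59 ≤ n) (hA : A ≤ n)
    (hk : (k : ℝ) + 5 ≤ Real.log n) (hd : d ≤ A * n ^ k) (hm : 1 ≤ m) (hφ : 1 / 2 ≤ φ)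
    (hD : 2 ^ D ≤ n ^ 2) (hDlog : (D : ℝ) ≤ 3 * Real.log n) :
    ((2 ^ D : ℕ) : ℝ) * (2 * (m * d) /
      ((1 / (4 * (n : ℝ) ^ 4)) ^ (4 * 2 ^ 57 * D) / (8 * n * φ)) + 1) ≤
      m * φ * (n : ℝ) ^ ((2 : ℝ) ^ 64 * Real.log n ^ 10) := by
  set M := 4 * 2 ^ 57 * D with hM
  have hn59 : (2 : ℝ) ^ 59 ≤ n := by exact_mod_cast hn
  have hn18 : (18 : ℝ) ≤ n := le_trans (by norm_num) hn59
  have hn0 : (0 : ℝ) < n := by linarith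
  have hn1 : (1 : ℝ) ≤ n := by linarith
  have hm1 : (1 : ℝ) ≤ m := by exact_mod_cast hm
  have hφ0 : 0 < φ := by linarith
  have hL : ((2 ^ D : ℕ) : ℝ) ≤ n ^ 2 := by exact_mod_cast hD
  have hdn : (d : ℝ) ≤ n ^ (k + 1) := by
    have : d ≤ n ^ (k + 1) := hd.trans (by rw [pow_succ, mul_comm]; gcongr)
    exact_mod_cast this
  have hX : (4 * (n : ℝ) ^ 4) ^ M ≤ n ^ (5 * M) := by
    have h4 : 4 * (n : ℝ) ^ 4 ≤ (n : ℝ) ^ 5 := by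
      have : (0 : ℝ) ≤ (n : ℝ) ^ 4 := by positivity
      nlinarith
    rw [pow_mul (n : ℝ)]
    exact pow_le_pow_left₀ (by positivity) h4 _
  have hmφ : 1 ≤ 2 * (m * φ) := by nlinarith
  have e : 2 * ((m : ℝ) * d) / ((1 / (4 * (n : ℝ) ^ 4)) ^ M / (8 * n * φ)) =
      m * φ * (16 * d * n * (4 * (n : ℝ) ^ 4) ^ M) := by
    rw [one_div, inv_pow]
    field_simp
    ring
  rw [e]
  have h1 : 16 * (d : ℝ) * n * (4 * (n : ℝ) ^ 4) ^ M ≤ 16 * n ^ (k + 2 + 5 * M) := by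
    calc 16 * (d : ℝ) * n * (4 * (n : ℝ) ^ 4) ^ M ≤ 16 * n ^ (k + 1) * n * n ^ (5 * M) := by gcongr
      _ = _ := by ring
  have h2 : (1 : ℝ) ≤ n ^ (k + 2 + 5 * M) := one_le_pow₀ hn1
  have hpos : 0 ≤ (m : ℝ) * φ := by positivity
  calc ((2 ^ D : ℕ) : ℝ) * (m * φ * (16 * d * n * (4 * (n : ℝ) ^ 4) ^ M) + 1)
      ≤ n ^ 2 * (m * φ * (16 * n ^ (k + 2 + 5 * M)) + 2 * (m * φ) * n ^ (k + 2 + 5 * M)) := by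
        gcongr
        calc (1 : ℝ) = 1 * 1 := by ring
          _ ≤ _ := mul_le_mul hmφ h2 (by norm_num) (by positivity)
    _ = m * φ * (n ^ 2 * (18 * n ^ (k + 2 + 5 * M))) := by ring
    _ ≤ m * φ * (n ^ 2 * (n * n ^ (k + 2 + 5 * M))) := by gcongr
    _ = m * φ * n ^ (k + 5 + 5 * M) := by ring
    _ = m * φ * (n : ℝ) ^ ((k + 5 + 5 * M : ℕ) : ℝ) := by rw [Real.rpow_natCast]
    _ ≤ _ := by
      -- The exponent is `k + 5 + 20 * 2 ^ 57 * D`, at most `(1 + 60 * 2 ^ 57) * log n`, below `2 ^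
      -- 64 * log n`.
      gcongr
      have hlog1 : 1 ≤ Real.log n := by
        have : (0 : ℝ) ≤ k := by positivity
        linarith
      have hlog : Real.log n ≤ Real.log n ^ 10 := le_self_pow₀ hlog1 (by norm_num)
      rw [hM]
      push_cast
      nlinarith

theorem BFOP.le_real_terminating {n m d A k : ℕ} {I : BFOP n m d} (hI : I.Complete)
    (hn : 2 ^ 59 ≤ n) (hA : A ≤ n) (hk : (k : ℝ) + 5 ≤ Real.log n) (hd : d ≤ A * n ^ k) {φ : ℝ}
    {μ : Fin m → Measure ℝ} (hφ : 0 < φ) (hμ : ∀ i, IsSmoothedWeight φ (μ i)) :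
    1 - 3 / (n : ℝ) ≤ (Measure.pi μ).real {w | I.TwoFlipTerminatesWithin w
      ((m : ℝ) * φ * (n : ℝ) ^ ((2 : ℝ) ^ 64 * Real.log (n : ℝ) ^ 10))} := by
  have := fun i => (hμ i).1
  have hn2 : 2 ≤ n := le_trans (by norm_num) hn
  have hn0 : (0 : ℝ) < n := by exact_mod_cast (by omega : 0 < n)
  obtain ⟨i₀, -⟩ := hI ⟨0, by omega⟩ ⟨1, by omega⟩ (by simp)
  have hφ2 := (hμ i₀).half_le
  set D := Nat.log 2 (2 ^ 58 * n) + 1 with hDdef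
  have hD1 : 2 * 2 ^ 57 * n < 2 ^ D := by
    have := Nat.lt_pow_succ_log_self (b := 2) (by norm_num) (2 ^ 58 * n)
    calc 2 * 2 ^ 57 * n = 2 ^ 58 * n := by norm_num
      _ < _ := this
  have hD2 : 2 ^ D ≤ n ^ 2 := by
    have := Nat.pow_log_le_self 2 (x := 2 ^ 58 * n) (by positivity)
    calc 2 ^ D = 2 ^ Nat.log 2 (2 ^ 58 * n) * 2 := pow_succ _ _
      _ ≤ 2 ^ 58 * n * 2 := Nat.mul_le_mul_right _ this
      _ = 2 ^ 59 * n := by ring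
      _ ≤ n * n := Nat.mul_le_mul_right _ hn
      _ = n ^ 2 := (sq n).symm
  have hlog0 : 0 ≤ Real.log n := Real.log_natCast_nonneg n
  have hDlog : (D : ℝ) ≤ 3 * Real.log n := by
    have h1 : ((2 : ℝ) ^ D) ≤ n ^ 2 := by exact_mod_cast hD2
    have h2 := Real.log_le_log (by positivity) h1
    rw [Real.log_pow, Real.log_pow] at h2
    have h3 := Real.log_two_gt_d9
    push_cast at h2
    have h4 : (0 : ℝ) ≤ D := by positivity
    nlinarith
  set ε : ℝ := (1 / (4 * (n : ℝ) ^ 4)) ^ (4 * 2 ^ 57 * D) / (8 * n * φ) with hεdef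
  have hε : 0 < ε := by positivity
  have hslow := pi_slowWeights_le hI (by omega) hD1 μ φ ε hφ hε
    (fun i => (hμ i).le_smul_volume) (by rw [hεdef]; field_simp)
  have hδ : ((D : ℝ) + 1) * (1 / n ^ 2) ≤ 3 / n := by
    have h1 := Real.log_le_sub_one_of_pos hn0
    rw [mul_one_div, div_le_div_iff₀ (by positivity) hn0]
    nlinarith
  set S := {w | I.TwoFlipTerminatesWithin w
      ((m : ℝ) * φ * (n : ℝ) ^ ((2 : ℝ) ^ 64 * Real.log (n : ℝ) ^ 10))} with hS
  have hcover : (Set.univ : Set (Fin m → ℝ)) ⊆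
      (S ∪ I.slowWeights (2 ^ D) ε) ∪ {w | ∀ i, |w i| ≤ 1}ᶜ := by
    intro w _
    by_cases h1 : ∀ i, |w i| ≤ 1
    · by_cases h2 : w ∈ I.slowWeights (2 ^ D) ε
      · exact Or.inl (Or.inr h2)
      · exact Or.inl (Or.inl (twoFlipTerminatesWithin w h1 hε h2
          (step_bound_le hn hA hk hd i₀.pos hφ2 hD2 hDlog)))
    · exact Or.inr h1
  have hprob : (1 : ENNReal) ≤ Measure.pi μ S + ENNReal.ofReal (3 / n) := by
    calc (1 : ENNReal) = Measure.pi μ Set.univ := measure_univ.symm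
      _ ≤ _ := measure_mono hcover
      _ ≤ Measure.pi μ (S ∪ I.slowWeights (2 ^ D) ε) + Measure.pi μ {w | ∀ i, |w i| ≤ 1}ᶜ :=
        measure_union_le _ _
      _ = Measure.pi μ (S ∪ I.slowWeights (2 ^ D) ε) := by
        rw [pi_forall_abs_le_one hμ, add_zero]
      _ ≤ Measure.pi μ S + Measure.pi μ (I.slowWeights (2 ^ D) ε) := measure_union_le _ _
      _ ≤ _ := by gcongr; exact hslow.trans (ENNReal.ofReal_le_ofReal hδ)
  have h1 := ENNReal.toReal_mono (by finiteness) hprob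
  rw [ENNReal.toReal_add (by finiteness) (by finiteness), ENNReal.toReal_ofReal (by positivity),
    ENNReal.toReal_one] at h1
  rw [measureReal_def]
  linarith

theorem exists_failure_probability (A k : ℕ) : ∃ δ : ℕ → ℝ, Tendsto δ atTop (𝓝 0) ∧
    ∀ (n m d : ℕ) (I : BFOP n m d), d ≤ A * n ^ k → I.Complete →
      ∀ (φ : ℝ) (μ : Fin m → Measure ℝ), 0 < φ → (∀ i, IsSmoothedWeight φ (μ i)) →
        1 - δ n ≤ (Measure.pi μ).real {w | I.TwoFlipTerminatesWithin w
          ((m : ℝ) * φ * (n : ℝ) ^ ((2 : ℝ) ^ 64 * Real.log (n : ℝ) ^ 10))} := by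
  have hlog : ∀ᶠ n : ℕ in atTop, (k : ℝ) + 5 ≤ Real.log n :=
    (Real.tendsto_log_atTop.comp tendsto_natCast_atTop_atTop).eventually_ge_atTop _
  obtain ⟨N, hN⟩ := eventually_atTop.1
    (hlog.and ((eventually_ge_atTop (2 ^ 59)).and (eventually_ge_atTop A)))
  -- Below the threshold, which depends only on `A` and `k`, the value 1 makes the claim trivial.
  refine ⟨fun n => if n < N then 1 else 3 / (n : ℝ), ?_, ?_⟩
  · refine (tendsto_const_div_atTop_nhds_zero_nat 3).congr' ?_
    filter_upwards [eventually_ge_atTop N] with n hn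
    rw [if_neg (not_lt.2 hn)]
  · intro n m d I hd hI φ μ hφ hμ
    dsimp only
    split_ifs with h
    · rw [sub_self]
      exact measureReal_nonneg
    · obtain ⟨h1, h2, h3⟩ := hN n (not_lt.1 h)
      exact BFOP.le_real_terminating hI h2 h3 h1 hd hφ hμ

end Main

theorem theorem3 :
    ∃ C : ℝ,
      -- Binary Function Optimization Problems with values in `{0, …, d}`,
      -- where `d` is polynomially bounded in `n` (in particular, a constant for `k = 0`)
      (∀ A k : ℕ, ∃ δ : ℕ → ℝ, Tendsto δ atTop (𝓝 0) ∧
        ∀ (n m d : ℕ) (I : BFOP n m d), d ≤ A * n ^ k → I.Complete →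
          ∀ (φ : ℝ) (μ : Fin m → Measure ℝ), 0 < φ → (∀ i, IsSmoothedWeight φ (μ i)) →
            1 - δ n ≤ (Measure.pi μ).real
              {w | I.TwoFlipTerminatesWithin w
                ((m : ℝ) * φ * (n : ℝ) ^ (C * Real.log (n : ℝ) ^ 10))}) ∧
      -- MAX 2-CSP
      (∃ δ : ℕ → ℝ, Tendsto δ atTop (𝓝 0) ∧
        ∀ (n m : ℕ) (I : Max2CSP n m), I.toBFOP.Complete →
          ∀ (φ : ℝ) (μ : Fin m → Measure ℝ), 0 < φ → (∀ i, IsSmoothedWeight φ (μ i)) →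
            1 - δ n ≤ (Measure.pi μ).real
              {w | I.toBFOP.TwoFlipTerminatesWithin w
                ((m : ℝ) * φ * (n : ℝ) ^ (C * Real.log (n : ℝ) ^ 10))}) := by
  refine ⟨(2 : ℝ) ^ 64, exists_failure_probability, ?_⟩
  obtain ⟨δ, hδ, h⟩ := exists_failure_probability 1 0
  exact ⟨δ, hδ, fun n m I hI φ μ hφ hμ => h n m 1 I.toBFOP (by simp) hI φ μ hφ hμ⟩
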